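/- Let $N_B$ and $N_F$ be lattices (free abelian groups of finite rank), put $N=N_B\times N_F$, and let $T_B$, $T_F$ and $T=T_B\times T_F$ be the complex algebraic tori with cocharacter lattices $N_B$, $N_F$ and $N$. Let $\Sigma_B$ and $\Sigma_F$ be rational polyhedral fans in $(N_B)_{\mathbb R}$ and $(N_F)_{\mathbb R}$, that is, finite non-empty sets of strongly convex rational polyhedral cones that contain all faces of their members and in which any two members meet in a common face; write $|\Sigma_B|$ for the union of the cones of $\Sigma_B$, and $X_\Sigma$ for the complex toric variety of a fan $\Sigma$. A twisting map on $\Sigma_B$ is a map $\Phi:|\Sigma_B|\to (N_F)_{\mathbb R}$ whose restriction to every cone of $\Sigma_B$ is the restriction of the linear map induced by some homomorphism $N_B\to N_F$. The twisted product is the fan in $N_{\mathbb R}$ $$\Sigma_B\ltimes_\Phi\Sigma_F=\{\widetilde\sigma+\tau \mid \sigma\in\Sigma_B,\ \tau\in\Sigma_F\},\qquad \widetilde\sigma=\{(x,\Phi(x))\mid x\in\sigma\},$$ where $\tau$ is regarded as the cone $\{0\}\times\tau$. The projection $N\to N_B$ induces a toric morphism $\pi_\Phi: X_{\Sigma_B\ltimes_\Phi\Sigma_F}\to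 X_{\Sigma_B}$, which is a Zariski-locally trivial bundle with fibre $X_{\Sigma_F}$; with it, $X_{\Sigma_B\ltimes_\Phi\Sigma_F}$ is a fibered toric variety over $X_{\Sigma_B}$. Let $\Phi,\Phi'$ be twisting maps on $\Sigma_B$ that differ by a global linear map: there is $\varphi\in\mathrm{Hom}(N_B,N_F)$ with $\Phi'(x)=\Phi(x)+\varphi(x)$ for all $x\in|\Sigma_B|$. Put $\Sigma=\Sigma_B\ltimes_\Phi\Sigma_F$ and $\Sigma'=\Sigma_B\ltimes_{\Phi'}\Sigma_F$. Then $X_\Sigma$ and $X_{\Sigma'}$ are isomorphic as fibered toric varieties over $X_{\Sigma_B}$. More precisely, the lattice automorphism $$\widetilde\varphi: N\to N,\qquad (v_1,v_2)\mapsto (v_1,\,v_2+\varphi(v_1)),$$ is a map of fans from $\Sigma$ to $\Sigma'$, and the toric morphism $f: X_\Sigma\to X_{\Sigma'}$ that it induces is an isomorphism of schemes over $\mathbb C$ which satisfies $\pi_{\Phi'}\circ f=\pi_\Phi$, restricts on $T$ to the automorphism of $T$ induced by $\widetilde\varphi$, and is equivariant along this automorphism of $T$. -/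

import Mathlib

open CategoryTheory CategoryTheory.Limits AlgebraicGeometry
open scoped TensorProduct

noncomputable section

namespace Toric

/-! ### Lattices, cones and fans -/

section Lattice

variable (N : Type) [AddCommGroup N]

/-- The real vector space `N_ℝ = ℝ ⊗ N` of a lattice `N`. -/
abbrev RealSpace : Type := ℝ ⊗[ℤ] N

/-- The dual lattice `M = Hom(N, ℤ)`. -/
abbrev DualLattice : Type := Module.Dual ℤ N

end Lattice

variable {N N' N'' : Type} [AddCommGroup N] [AddCommGroup N'] [AddCommGroup N'']

/-- The pairing `⟨m, ·⟩ : N_ℝ → ℝ` of an element `m` of the dual lattice. -/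
def pairing (m : DualLattice N) : RealSpace N →ₗ[ℝ] ℝ :=
  Module.Dual.baseChange ℝ m

lemma pairing_tmul (m : DualLattice N) (r : ℝ) (v : N) :
    pairing m (r ⊗ₜ[ℤ] v) = r * (m v : ℝ) := by
  simp [pairing, mul_comm]

lemma pairing_add (m m' : DualLattice N) (x : RealSpace N) :
    pairing (m + m') x = pairing m x + pairing m' x := by
  simp [pairing]

lemma pairing_zero (x : RealSpace N) : pairing (0 : DualLattice N) x = 0 := by
  simp [pairing]

lemma pairing_baseChange (φ : N →ₗ[ℤ] N') (m : DualLattice N') (x : RealSpace N) :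
    pairing m (φ.baseChange ℝ x) = pairing (m ∘ₗ φ) x := by
  induction x using TensorProduct.induction_on with
  | zero => simp
  | tmul r v => simp [pairing_tmul]
  | add a b ha hb => simp [ha, hb]

/-- A rational polyhedral cone: generated by finitely many lattice vectors. -/
def IsRational (σ : PointedCone ℝ (RealSpace N)) : Prop :=
  ∃ S : Finset N, σ = PointedCone.hull ℝ ((fun v : N => (1 : ℝ) ⊗ₜ[ℤ] v) '' S)

lemma IsRational.map {σ : PointedCone ℝ (RealSpace N)} (hσ : IsRational σ) (φ : N →ₗ[ℤ] N') :
    IsRational (PointedCone.map (φ.baseChange ℝ) σ) := by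
  classical
  obtain ⟨S, rfl⟩ := hσ
  refine ⟨S.image φ, ?_⟩
  rw [PointedCone.map, PointedCone.hull, Submodule.map_span, PointedCone.hull, Finset.coe_image,
    Set.image_image, Set.image_image]
  congr 1

lemma IsRational.sup {σ τ : PointedCone ℝ (RealSpace N)} (hσ : IsRational σ)
    (hτ : IsRational τ) : IsRational (σ ⊔ τ) := by
  classical
  obtain ⟨S, rfl⟩ := hσ
  obtain ⟨T, rfl⟩ := hτ
  refine ⟨S ∪ T, ?_⟩
  rw [PointedCone.hull, PointedCone.hull, PointedCone.hull, Finset.coe_union, Set.image_union,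
    Submodule.span_union]

/-- `τ` is a face of the rational cone `σ`: it is cut out in `σ` by the hyperplane `m = 0`
for a lattice functional `m` that is non-negative on `σ`. -/
def IsFace (τ σ : PointedCone ℝ (RealSpace N)) : Prop :=
  ∃ m : DualLattice N, (∀ x ∈ σ, 0 ≤ pairing m x) ∧ ∀ x, x ∈ τ ↔ x ∈ σ ∧ pairing m x = 0

lemma isFace_cut {σ : PointedCone ℝ (RealSpace N)} {m : DualLattice N}
    (hm : ∀ x ∈ σ, 0 ≤ pairing m x) :
    IsFace (σ ⊓ PointedCone.ofSubmodule (LinearMap.ker (pairing m))) σ :=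
  ⟨m, hm, fun _ => Iff.rfl⟩

variable (N) in
/-- A rational polyhedral fan in `N_ℝ`: a finite non-empty set of strongly convex rational
polyhedral cones, closed under faces, any two of which meet in a common face.
(Non-emptiness is expressed by containing the zero cone, which is a face of every cone.) -/
structure Fan where
  cones : Set (PointedCone ℝ (RealSpace N))
  finite : cones.Finite
  bot_mem : ⊥ ∈ cones
  rational : ∀ σ ∈ cones, IsRational σ
  salient : ∀ σ ∈ cones, (σ : ConvexCone ℝ (RealSpace N)).Salient
  face_mem : ∀ σ ∈ cones, ∀ τ, IsFace τ σ → τ ∈ cones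
  inf_isFace : ∀ σ ∈ cones, ∀ τ ∈ cones, IsFace (σ ⊓ τ) σ

namespace Fan

/-- The support `|Σ|`: the union of the cones. -/
def support (F : Fan N) : Set (RealSpace N) := ⋃ σ ∈ F.cones, (σ : Set (RealSpace N))

lemma mem_support {F : Fan N} {σ : PointedCone ℝ (RealSpace N)} (hσ : σ ∈ F.cones)
    {x : RealSpace N} (hx : x ∈ σ) : x ∈ F.support :=
  Set.mem_biUnion hσ hx

lemma inf_mem (F : Fan N) {σ τ : PointedCone ℝ (RealSpace N)} (hσ : σ ∈ F.cones)
    (hτ : τ ∈ F.cones) : σ ⊓ τ ∈ F.cones :=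
  F.face_mem σ hσ _ (F.inf_isFace σ hσ τ hτ)

lemma isFace_of_le (F : Fan N) {σ τ : PointedCone ℝ (RealSpace N)} (hσ : σ ∈ F.cones)
    (hτ : τ ∈ F.cones) (h : τ ≤ σ) : IsFace τ σ := by
  have := F.inf_isFace σ hσ τ hτ
  rwa [inf_eq_right.mpr h] at this

end Fan

/-! ### Affine charts -/

/-- The semigroup `S_σ = σ^∨ ∩ M`. -/
def semigroup (σ : PointedCone ℝ (RealSpace N)) : AddSubmonoid (DualLattice N) where
  carrier := {m | ∀ x ∈ σ, 0 ≤ pairing m x}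
  zero_mem' := fun x _ => (pairing_zero x).ge
  add_mem' := fun {a b} ha hb x hx => by
    rw [pairing_add]; exact add_nonneg (ha x hx) (hb x hx)

/-- The semigroup algebra `ℂ[S_σ]`. -/
abbrev chartRing (σ : PointedCone ℝ (RealSpace N)) : Type :=
  AddMonoidAlgebra ℂ (semigroup σ)

/-- The affine toric variety `U_σ = Spec ℂ[S_σ]`. -/
abbrev chart (σ : PointedCone ℝ (RealSpace N)) : Scheme.{0} :=
  Spec (CommRingCat.of (chartRing σ))

/-- `φ_ℝ` maps the cone `σ` into the cone `σ'`. -/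
def MapsCone (φ : N →ₗ[ℤ] N') (σ : PointedCone ℝ (RealSpace N))
    (σ' : PointedCone ℝ (RealSpace N')) : Prop :=
  ∀ x ∈ σ, φ.baseChange ℝ x ∈ σ'

lemma MapsCone.comp {φ : N →ₗ[ℤ] N'} {ψ : N' →ₗ[ℤ] N''} {σ : PointedCone ℝ (RealSpace N)}
    {σ' : PointedCone ℝ (RealSpace N')} {σ'' : PointedCone ℝ (RealSpace N'')}
    (h : MapsCone φ σ σ') (h' : MapsCone ψ σ' σ'') : MapsCone (ψ ∘ₗ φ) σ σ'' := by
  intro x hx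
  rw [LinearMap.baseChange_comp]
  exact h' _ (h x hx)

lemma MapsCone.of_le {σ τ : PointedCone ℝ (RealSpace N)} (h : σ ≤ τ) :
    MapsCone LinearMap.id σ τ := by
  intro x hx
  rw [LinearMap.baseChange_id]
  exact h hx

/-- The homomorphism `S_σ' → S_σ`, `m ↦ m ∘ φ`, for `φ_ℝ(σ) ⊆ σ'`. -/
def semigroupMap (φ : N →ₗ[ℤ] N') {σ : PointedCone ℝ (RealSpace N)}
    {σ' : PointedCone ℝ (RealSpace N')} (h : MapsCone φ σ σ') :
    semigroup σ' →+ semigroup σ where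
  toFun m := ⟨m.1 ∘ₗ φ, fun x hx => by
    rw [← pairing_baseChange]; exact m.2 _ (h x hx)⟩
  map_zero' := rfl
  map_add' _ _ := rfl

/-- The morphism `U_σ → U_σ'`, given by `χ^m ↦ χ^(m ∘ φ)`, for `φ_ℝ(σ) ⊆ σ'`. -/
def chartMap (φ : N →ₗ[ℤ] N') {σ : PointedCone ℝ (RealSpace N)}
    {σ' : PointedCone ℝ (RealSpace N')} (h : MapsCone φ σ σ') : chart σ ⟶ chart σ' :=
  Spec.map (CommRingCat.ofHom (AddMonoidAlgebra.mapDomainRingHom ℂ (semigroupMap φ h)))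

lemma chartMap_comp {φ : N →ₗ[ℤ] N'} {ψ : N' →ₗ[ℤ] N''} {σ : PointedCone ℝ (RealSpace N)}
    {σ' : PointedCone ℝ (RealSpace N')} {σ'' : PointedCone ℝ (RealSpace N'')}
    (h : MapsCone φ σ σ') (h' : MapsCone ψ σ' σ'') :
    chartMap φ h ≫ chartMap ψ h' = chartMap (ψ ∘ₗ φ) (h.comp h') := by
  rw [chartMap, chartMap, ← Spec.map_comp, ← CommRingCat.ofHom_comp,
    ← AddMonoidAlgebra.mapDomainRingHom_comp]
  rfl

lemma chartMap_congr {φ ψ : N →ₗ[ℤ] N'} (e : φ = ψ) {σ : PointedCone ℝ (RealSpace N)}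
    {σ' : PointedCone ℝ (RealSpace N')} (h : MapsCone φ σ σ') (h' : MapsCone ψ σ σ') :
    chartMap φ h = chartMap ψ h' := by
  subst e; rfl

lemma chartMap_id_comp {φ : N →ₗ[ℤ] N'} {σ τ : PointedCone ℝ (RealSpace N)}
    {σ' : PointedCone ℝ (RealSpace N')} (h : MapsCone LinearMap.id σ τ) (h' : MapsCone φ τ σ')
    (h'' : MapsCone φ σ σ') : chartMap LinearMap.id h ≫ chartMap φ h' = chartMap φ h'' := by
  rw [chartMap_comp]
  exact chartMap_congr (LinearMap.comp_id φ) _ _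

lemma chartMap_comp_id {φ : N →ₗ[ℤ] N'} {σ : PointedCone ℝ (RealSpace N)}
    {σ' τ' : PointedCone ℝ (RealSpace N')} (h : MapsCone φ σ σ') (h' : MapsCone LinearMap.id σ' τ')
    (h'' : MapsCone φ σ τ') : chartMap φ h ≫ chartMap LinearMap.id h' = chartMap φ h'' := by
  rw [chartMap_comp]
  exact chartMap_congr (LinearMap.id_comp φ) _ _

lemma chartMap_id {σ : PointedCone ℝ (RealSpace N)} (h : MapsCone LinearMap.id σ σ) :
    chartMap LinearMap.id h = 𝟙 (chart σ) := by
  have : semigroupMap LinearMap.id h = AddMonoidHom.id (semigroup σ) := rfl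
  rw [chartMap, this, AddMonoidAlgebra.mapDomainRingHom_id]
  exact Spec.map_id _

/-! ### The inclusion of the chart of a face is a principal open immersion -/

lemma exists_add_nsmul_mem {σ τ : PointedCone ℝ (RealSpace N)} (hσ : IsRational σ)
    {m : DualLattice N} (hm : ∀ x ∈ σ, 0 ≤ pairing m x)
    (hτ : ∀ x, x ∈ τ ↔ x ∈ σ ∧ pairing m x = 0) (m' : DualLattice N) (hm' : m' ∈ semigroup τ) :
    ∃ k : ℕ, m' + k • m ∈ semigroup σ := by
  obtain ⟨S, hS⟩ := hσ
  refine ⟨∑ v ∈ S, (m' v).natAbs, ?_⟩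
  set k := ∑ v ∈ S, (m' v).natAbs with hk
  have key : ∀ v ∈ S, 0 ≤ (m' + k • m) v := by
    intro v hv
    have hvσ : (1 : ℝ) ⊗ₜ[ℤ] v ∈ σ := by
      rw [hS]; exact Submodule.subset_span ⟨v, hv, rfl⟩
    have h0 : 0 ≤ m v := by
      have := hm _ hvσ
      rw [pairing_tmul, one_mul] at this
      exact_mod_cast this
    have hkv : (m' v).natAbs ≤ k :=
      Finset.single_le_sum (f := fun v => (m' v).natAbs) (fun _ _ => Nat.zero_le _) hv
    simp only [LinearMap.add_apply, LinearMap.smul_apply, nsmul_eq_mul]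
    rcases h0.eq_or_lt with h0 | h0
    · have hvτ : (1 : ℝ) ⊗ₜ[ℤ] v ∈ τ := by
        rw [hτ, pairing_tmul, ← h0]; simpa using hvσ
      have := hm' _ hvτ
      rw [pairing_tmul, one_mul] at this
      have : 0 ≤ m' v := by exact_mod_cast this
      rw [← h0]; simpa using this
    · have h1 : (k : ℤ) ≤ k * m v := by nlinarith [Int.natCast_nonneg k]
      omega
  intro x hx
  rw [hS] at hx
  induction hx using Submodule.span_induction with
  | mem y hy =>
    obtain ⟨v, hv, rfl⟩ := hy
    simp only [pairing_tmul, one_mul]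
    exact_mod_cast key v hv
  | zero => simp
  | add a b _ _ ha hb => rw [map_add]; exact add_nonneg ha hb
  | smul r a _ ha =>
    change 0 ≤ pairing _ ((r : ℝ) • a)
    rw [map_smul]
    exact mul_nonneg r.2 ha

/-- The localization statement: for the face `τ = σ ∩ m^⊥`, the ring `ℂ[S_τ]` is `ℂ[S_σ]` with
`χ^m` inverted. -/
lemma isLocalization_face {σ τ : PointedCone ℝ (RealSpace N)} (hσ : IsRational σ)
    {m : DualLattice N} (hm : m ∈ semigroup σ)
    (hτ : ∀ x, x ∈ τ ↔ x ∈ σ ∧ pairing m x = 0) (h : MapsCone LinearMap.id τ σ) :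
    letI := (AddMonoidAlgebra.mapDomainRingHom ℂ (semigroupMap LinearMap.id h)).toAlgebra
    IsLocalization.Away (AddMonoidAlgebra.single (⟨m, hm⟩ : semigroup σ) (1 : ℂ))
      (chartRing τ) := by
  let := (AddMonoidAlgebra.mapDomainRingHom ℂ (semigroupMap LinearMap.id h)).toAlgebra
  have halg : ∀ a : chartRing σ, algebraMap (chartRing σ) (chartRing τ) a =
    AddMonoidAlgebra.mapDomain (semigroupMap LinearMap.id h) a := fun _ => rfl
  have hinj : Function.Injective (semigroupMap LinearMap.id h) := by
    intro a b hab
    exact Subtype.ext (congrArg (fun t : semigroup τ => t.1) hab)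
  have hmτ : m ∈ semigroup τ := fun x hx => (((hτ x).mp hx).2).ge
  have hnτ : -m ∈ semigroup τ := fun x hx => by
    have := ((hτ x).mp hx).2
    have e : pairing (-m) x = -pairing m x := by
      have := pairing_add m (-m) x
      rw [add_neg_cancel, pairing_zero] at this
      linarith
    rw [e, this]; simp
  have hunit : IsUnit (algebraMap (chartRing σ) (chartRing τ)
      (AddMonoidAlgebra.single (⟨m, hm⟩ : semigroup σ) (1 : ℂ))) := by
    refine IsUnit.of_mul_eq_one
      (AddMonoidAlgebra.single (⟨-m, hnτ⟩ : semigroup τ) (1 : ℂ)) ?_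
    rw [halg, AddMonoidAlgebra.mapDomain_single, AddMonoidAlgebra.single_mul_single,
      AddMonoidAlgebra.one_def, one_mul]
    congr 1
    exact Subtype.ext (add_neg_cancel m)
  have hsurj : ∀ z : chartRing τ, ∃ (k : ℕ) (a : chartRing σ),
      z * algebraMap (chartRing σ) (chartRing τ)
        (AddMonoidAlgebra.single (⟨m, hm⟩ : semigroup σ) (1 : ℂ)) ^ k =
      algebraMap (chartRing σ) (chartRing τ) a := by
    intro z
    induction z using AddMonoidAlgebra.induction_linear with
    | zero => exact ⟨0, 0, by simp⟩
    | add f g hf hg =>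
      obtain ⟨k, a, ha⟩ := hf
      obtain ⟨l, b, hb⟩ := hg
      refine ⟨k + l, a * AddMonoidAlgebra.single (⟨m, hm⟩ : semigroup σ) (1 : ℂ) ^ l +
        b * AddMonoidAlgebra.single (⟨m, hm⟩ : semigroup σ) (1 : ℂ) ^ k, ?_⟩
      rw [map_add, map_mul, map_mul, ← ha, ← hb, map_pow, map_pow]
      ring
    | single m' r =>
      obtain ⟨k, hk⟩ := exists_add_nsmul_mem hσ hm hτ m'.1 m'.2
      refine ⟨k, AddMonoidAlgebra.single ⟨_, hk⟩ r, ?_⟩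
      rw [halg, halg, AddMonoidAlgebra.mapDomain_single, AddMonoidAlgebra.mapDomain_single,
        AddMonoidAlgebra.single_pow, AddMonoidAlgebra.single_mul_single, one_pow, mul_one]
      congr 1
  refine ⟨?_, ?_, ?_⟩
  · rintro ⟨_, k, rfl⟩
    rw [map_pow]
    exact hunit.pow k
  · intro z
    obtain ⟨k, a, ha⟩ := hsurj z
    refine ⟨(a, ⟨_, k, rfl⟩), ?_⟩
    dsimp only
    rw [map_pow]
    exact ha
  · intro x y hxy
    exact ⟨1, by rw [AddMonoidAlgebra.mapDomain_injective hinj hxy]⟩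

lemma isOpenImmersion_chartMap {σ τ : PointedCone ℝ (RealSpace N)} (hσ : IsRational σ)
    (hτ : IsFace τ σ) (h : MapsCone LinearMap.id τ σ) :
    IsOpenImmersion (chartMap LinearMap.id h) := by
  obtain ⟨m, hm, hτ⟩ := hτ
  let := (AddMonoidAlgebra.mapDomainRingHom ℂ (semigroupMap LinearMap.id h)).toAlgebra
  have := isLocalization_face hσ hm hτ h
  exact IsOpenImmersion.of_isLocalization
    (AddMonoidAlgebra.single (⟨m, hm⟩ : semigroup σ) (1 : ℂ))

lemma range_chartMap {σ τ : PointedCone ℝ (RealSpace N)} (hσ : IsRational σ)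
    {m : DualLattice N} (hm : m ∈ semigroup σ)
    (hτ : ∀ x, x ∈ τ ↔ x ∈ σ ∧ pairing m x = 0) (h : MapsCone LinearMap.id τ σ) :
    Set.range (chartMap LinearMap.id h) =
      (PrimeSpectrum.basicOpen (AddMonoidAlgebra.single (⟨m, hm⟩ : semigroup σ) (1 : ℂ)) :
        Set (PrimeSpectrum (chartRing σ))) := by
  let := (AddMonoidAlgebra.mapDomainRingHom ℂ (semigroupMap LinearMap.id h)).toAlgebra
  have := isLocalization_face hσ hm hτ h
  exact PrimeSpectrum.localization_away_comap_range (chartRing τ)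
    (AddMonoidAlgebra.single (⟨m, hm⟩ : semigroup σ) (1 : ℂ))

/-! ### The toric variety of a fan -/

namespace Fan

variable (F : Fan N) (F' : Fan N')

/-- The diagram `σ ↦ U_σ` of affine charts, indexed by the cones of the fan ordered by
inclusion. -/
def diagram : F.cones ⥤ Scheme.{0} where
  obj σ := chart σ.1
  map {σ τ} f := chartMap LinearMap.id (MapsCone.of_le (show σ.1 ≤ τ.1 from leOfHom f))
  map_id _ := chartMap_id _
  map_comp _ _ :=
    (chartMap_id_comp _ _ _).symm

instance {σ τ : F.cones} (f : σ ⟶ τ) : IsOpenImmersion (F.diagram.map f) :=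
  isOpenImmersion_chartMap (F.rational _ τ.2) (F.isFace_of_le τ.2 σ.2 (leOfHom f)) _

instance : (F.diagram ⋙ Scheme.forget).IsLocallyDirected where
  cond := by
    intro σ₁ σ₂ ρ f₁ f₂ x₁ x₂ hx
    let l : F.cones := ⟨σ₁.1 ⊓ σ₂.1, F.inf_mem σ₁.2 σ₂.2⟩
    let g₁ : l ⟶ σ₁ := homOfLE (show σ₁.1 ⊓ σ₂.1 ≤ σ₁.1 from inf_le_left)
    let g₂ : l ⟶ σ₂ := homOfLE (show σ₁.1 ⊓ σ₂.1 ≤ σ₂.1 from inf_le_right)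
    change F.diagram.map f₁ x₁ = F.diagram.map f₂ x₂ at hx
    obtain ⟨m, hm, h2⟩ := F.isFace_of_le ρ.2 σ₂.2 (leOfHom f₂)
    have hm1 : m ∈ semigroup σ₁.1 := fun x hx => hm x (leOfHom f₁ hx)
    have hl : ∀ x, x ∈ l.1 ↔ x ∈ σ₁.1 ∧ pairing m x = 0 := by
      intro x
      change x ∈ σ₁.1 ⊓ σ₂.1 ↔ _
      rw [Submodule.mem_inf, h2]
      exact ⟨fun h => ⟨h.1, h.2.2⟩, fun h => ⟨h.1, leOfHom f₁ h.1, h.2⟩⟩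
    have r1 := range_chartMap (F.rational _ σ₁.2) hm1 hl (MapsCone.of_le (leOfHom g₁))
    have r2 := range_chartMap (F.rational _ ρ.2) hm h2 (MapsCone.of_le (leOfHom f₂))
    have hx1 : x₁ ∈ Set.range (F.diagram.map g₁) := by
      have : F.diagram.map f₂ x₂ ∈ Set.range (F.diagram.map f₂) := ⟨x₂, rfl⟩
      rw [← hx] at this
      have this := r2.subset this
      refine r1.symm.subset ?_
      intro hmem
      apply this
      change AddMonoidAlgebra.mapDomainRingHom ℂ
        (semigroupMap LinearMap.id (MapsCone.of_le (leOfHom f₁)))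
        (AddMonoidAlgebra.single (⟨m, hm⟩ : semigroup ρ.1) (1 : ℂ)) ∈ PrimeSpectrum.asIdeal x₁
      have e : AddMonoidAlgebra.mapDomainRingHom ℂ
        (semigroupMap LinearMap.id (MapsCone.of_le (leOfHom f₁)))
        (AddMonoidAlgebra.single (⟨m, hm⟩ : semigroup ρ.1) (1 : ℂ)) =
          AddMonoidAlgebra.single (⟨m, hm1⟩ : semigroup σ₁.1) (1 : ℂ) :=
        AddMonoidAlgebra.mapDomain_single
      rw [e]
      exact hmem
    obtain ⟨x, hx1⟩ := hx1
    refine ⟨l, g₁, g₂, x, hx1, ?_⟩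
    apply (F.diagram.map f₂).isOpenEmbedding.injective
    change F.diagram.map f₂ (F.diagram.map g₂ x) = _
    rw [← hx, ← hx1, ← Scheme.Hom.comp_apply, ← Scheme.Hom.comp_apply, ← Functor.map_comp,
      ← Functor.map_comp]
    rfl

/-- The toric variety `X_Σ` of a fan: the charts `U_σ`, `σ ∈ Σ`, glued along the open subschemes
`U_τ ⊆ U_σ` for the faces `τ` of `σ`. -/
def toricVariety : Scheme.{0} := colimit F.diagram

/-- The inclusion of the chart `U_σ` in `X_Σ`. -/
def chartIncl (σ : F.cones) : chart σ.1 ⟶ F.toricVariety := colimit.ι F.diagram σ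

lemma chartMap_chartIncl {σ τ : F.cones} (h : MapsCone LinearMap.id σ.1 τ.1) (h' : σ.1 ≤ τ.1) :
    chartMap LinearMap.id h ≫ F.chartIncl τ = F.chartIncl σ :=
  colimit.w F.diagram (homOfLE (show σ ≤ τ from h'))

/-- Morphisms out of `X_Σ` are glued from compatible morphisms on the charts. -/
def glue {Y : Scheme.{0}} (g : ∀ σ : F.cones, chart σ.1 ⟶ Y)
    (hg : ∀ (σ τ : F.cones) (h : σ.1 ≤ τ.1),
      chartMap LinearMap.id (MapsCone.of_le h) ≫ g τ = g σ) : F.toricVariety ⟶ Y :=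
  colimit.desc F.diagram
    { pt := Y
      ι :=
        { app := g
          naturality := fun σ τ f => (hg σ τ (leOfHom f)).trans (Category.comp_id (g σ)).symm } }

lemma chartIncl_glue {Y : Scheme.{0}} (g : ∀ σ : F.cones, chart σ.1 ⟶ Y) (hg) (σ : F.cones) :
    F.chartIncl σ ≫ F.glue g hg = g σ :=
  colimit.ι_desc _ _

lemma hom_ext {Y : Scheme.{0}} {f g : F.toricVariety ⟶ Y}
    (h : ∀ σ, F.chartIncl σ ≫ f = F.chartIncl σ ≫ g) : f = g :=
  colimit.hom_ext h

/-- The structure morphism `X_Σ → Spec ℂ`. -/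
def structureMap : F.toricVariety ⟶ Spec (CommRingCat.of ℂ) :=
  F.glue (fun σ => Spec.map (CommRingCat.ofHom (algebraMap ℂ (chartRing σ.1)))) (by
    intro σ τ h
    rw [chartMap, ← Spec.map_comp, ← CommRingCat.ofHom_comp]
    congr 2
    ext r
    simp)

end Fan

/-! ### Toric morphisms -/

/-- `φ : N → N'` is a map of fans: every cone of `F` is mapped into some cone of `F'`. -/
def IsFanMap (φ : N →ₗ[ℤ] N') (F : Fan N) (F' : Fan N') : Prop :=
  ∀ σ ∈ F.cones, ∃ σ' ∈ F'.cones, MapsCone φ σ σ'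

lemma chartMap_chartIncl_eq (φ : N →ₗ[ℤ] N') (F' : Fan N') {σ : PointedCone ℝ (RealSpace N)}
    {σ₁ σ₂ : F'.cones} (h₁ : MapsCone φ σ σ₁.1) (h₂ : MapsCone φ σ σ₂.1) :
    chartMap φ h₁ ≫ F'.chartIncl σ₁ = chartMap φ h₂ ≫ F'.chartIncl σ₂ := by
  let l : F'.cones := ⟨σ₁.1 ⊓ σ₂.1, F'.inf_mem σ₁.2 σ₂.2⟩
  have hl : MapsCone φ σ l.1 := fun x hx => ⟨h₁ x hx, h₂ x hx⟩
  have e₁ : chartMap φ h₁ = chartMap φ hl ≫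
      chartMap LinearMap.id (MapsCone.of_le (show l.1 ≤ σ₁.1 from inf_le_left)) :=
    (chartMap_comp_id _ _ _).symm
  have e₂ : chartMap φ h₂ = chartMap φ hl ≫
      chartMap LinearMap.id (MapsCone.of_le (show l.1 ≤ σ₂.1 from inf_le_right)) :=
    (chartMap_comp_id _ _ _).symm
  rw [e₁, e₂, Category.assoc, Category.assoc, F'.chartMap_chartIncl _ inf_le_left,
    F'.chartMap_chartIncl _ inf_le_right]

/-- The toric morphism `X_F → X_F'` induced by a map of fans `φ`: on a chart `U_σ` it is
`U_σ → U_σ' ⊆ X_F'`, `χ^m ↦ χ^(m ∘ φ)`, for any cone `σ'` containing `φ_ℝ(σ)`. -/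
def toricMap (φ : N →ₗ[ℤ] N') {F : Fan N} {F' : Fan N'} (h : IsFanMap φ F F') :
    F.toricVariety ⟶ F'.toricVariety :=
  F.glue (fun σ => chartMap φ (h σ.1 σ.2).choose_spec.2 ≫
      F'.chartIncl ⟨(h σ.1 σ.2).choose, (h σ.1 σ.2).choose_spec.1⟩) (by
    intro σ τ hστ
    have h' : MapsCone φ σ.1 (h τ.1 τ.2).choose :=
      fun x hx => (h τ.1 τ.2).choose_spec.2 x (hστ hx)
    rw [← Category.assoc, chartMap_id_comp _ _ h']
    exact chartMap_chartIncl_eq φ F' (σ₁ := ⟨_, _⟩) (σ₂ := ⟨_, _⟩) h' (h σ.1 σ.2).choose_spec.2)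

/-- The torus `T_N = Spec ℂ[M]`. -/
abbrev torus (N : Type) [AddCommGroup N] : Scheme.{0} :=
  Spec (CommRingCat.of (AddMonoidAlgebra ℂ (DualLattice N)))

/-- The homomorphism of tori `T_N → T_N'` induced by `φ : N → N'`, i.e. by
`χ^m ↦ χ^(m ∘ φ)`. -/
def torusMap (φ : N →ₗ[ℤ] N') : torus N ⟶ torus N' :=
  Spec.map (CommRingCat.ofHom
    (AddMonoidAlgebra.mapDomainRingHom ℂ φ.dualMap.toAddMonoidHom))

/-- The inclusion of the torus `T_N = U_{0}` in `X_F`, as the chart of the zero cone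
(for which `S_{0} = M`). -/
def torusIncl (F : Fan N) : torus N ⟶ F.toricVariety :=
  Spec.map (CommRingCat.ofHom (AddMonoidAlgebra.mapDomainRingHom ℂ
    (semigroup (⊥ : PointedCone ℝ (RealSpace N))).subtype)) ≫ F.chartIncl ⟨⊥, F.bot_mem⟩

/-- The group `T_N(ℂ) = Hom(M, ℂˣ)` of complex points of the torus. -/
abbrev TorusPoint (N : Type) [AddCommGroup N] : Type :=
  Multiplicative (DualLattice N) →* ℂˣ

/-- The homomorphism `T_N(ℂ) → T_N'(ℂ)` induced by `φ : N → N'`. -/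
def TorusPoint.map (φ : N →ₗ[ℤ] N') (t : TorusPoint N) : TorusPoint N' :=
  t.comp (AddMonoidHom.toMultiplicative φ.dualMap.toAddMonoidHom)

/-- The action of `t ∈ T_N(ℂ)` on the chart `U_σ`: `χ^m ↦ t(m) χ^m`. -/
def chartAct (t : TorusPoint N) (σ : PointedCone ℝ (RealSpace N)) : chart σ ⟶ chart σ :=
  Spec.map (CommRingCat.ofHom (AddMonoidAlgebra.lift ℂ (chartRing σ) (semigroup σ)
    { toFun := fun m => AddMonoidAlgebra.single m.toAdd
        ((t (Multiplicative.ofAdd (m.toAdd : DualLattice N)) : ℂˣ) : ℂ)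
      map_one' := by
        simp [AddMonoidAlgebra.one_def]
      map_mul' := fun a b => by
        simp [AddMonoidAlgebra.single_mul_single] }).toRingHom)

lemma chartMap_chartAct (t : TorusPoint N) (φ : N →ₗ[ℤ] N') {σ : PointedCone ℝ (RealSpace N)}
    {σ' : PointedCone ℝ (RealSpace N')} (h : MapsCone φ σ σ') :
    chartMap φ h ≫ chartAct (t.map φ) σ' = chartAct t σ ≫ chartMap φ h := by
  rw [chartMap, chartAct, chartAct, ← Spec.map_comp, ← Spec.map_comp, ← CommRingCat.ofHom_comp,
    ← CommRingCat.ofHom_comp]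
  congr 2
  ext m
  · simp
  · simp [TorusPoint.map, semigroupMap]
    rfl

/-- The action of `t ∈ T_N(ℂ)` on the toric variety `X_F`. -/
def torusAct (F : Fan N) (t : TorusPoint N) : F.toricVariety ⟶ F.toricVariety :=
  F.glue (fun σ => chartAct t σ.1 ≫ F.chartIncl σ) (by
    intro σ τ h
    have := chartMap_chartAct t LinearMap.id (MapsCone.of_le h)
    rw [← Category.assoc]
    change (_ ≫ chartAct (t.map LinearMap.id) τ.1) ≫ _ = _
    rw [this, Category.assoc, F.chartMap_chartIncl _ h])

/-! ### Fibre bundles and preimages of charts -/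

lemma isPullback_of_openCover {W U X S : Scheme.{0}} {a : W ⟶ U} {q : W ⟶ X} {s : U ⟶ S}
    {t : X ⟶ S} (w : a ≫ s = q ≫ t) (𝒰 : X.OpenCover) (V : 𝒰.I₀ → Scheme.{0})
    (v : ∀ i, V i ⟶ W) (r : ∀ i, V i ⟶ 𝒰.X i) (h₁ : ∀ i, IsPullback (v i) (r i) q (𝒰.f i))
    (h₂ : ∀ i, IsPullback (v i ≫ a) (r i) s (𝒰.f i ≫ t)) : IsPullback a q s t := by
  have hP : IsPullback (pullback.fst s t) (pullback.snd s t) s t := IsPullback.of_hasPullback _ _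
  obtain ⟨l, hl1, hl2⟩ : ∃ l : W ⟶ pullback s t, l ≫ pullback.fst s t = a ∧
      l ≫ pullback.snd s t = q := ⟨hP.lift a q w, hP.lift_fst _ _ _, hP.lift_snd _ _ _⟩
  have hl : IsIso l := by
    change MorphismProperty.isomorphisms Scheme l
    refine IsZariskiLocalAtTarget.of_openCover (𝒰.pullback₁ (pullback.snd s t)) fun i => ?_
    have hR : IsPullback (pullback.fst (pullback.snd s t) (𝒰.f i))
      (pullback.snd (pullback.snd s t) (𝒰.f i)) (pullback.snd s t) (𝒰.f i) :=
      IsPullback.of_hasPullback _ _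
    have hc : (v i ≫ l) ≫ pullback.snd s t = r i ≫ 𝒰.f i := by
      rw [Category.assoc, hl2, (h₁ i).w]
    obtain ⟨b, hb1, hb2⟩ : ∃ b : V i ⟶ pullback (pullback.snd s t) (𝒰.f i),
        b ≫ pullback.fst (pullback.snd s t) (𝒰.f i) = v i ≫ l ∧
        b ≫ pullback.snd (pullback.snd s t) (𝒰.f i) = r i :=
      ⟨hR.lift _ _ hc, hR.lift_fst _ _ _, hR.lift_snd _ _ _⟩
    have hL : IsPullback (v i) b l (pullback.fst (pullback.snd s t) (𝒰.f i)) := by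
      refine IsPullback.of_bot ?_ hb1.symm hR
      rw [hb2, hl2]
      exact h₁ i
    have K := hR.paste_horiz hP
    have hb : IsIso b := by
      have e : b = ((h₂ i).isoIsPullback _ _ K).hom := by
        apply K.hom_ext
        · rw [IsPullback.isoIsPullback_hom_fst, ← Category.assoc, hb1, Category.assoc, hl1]
        · rw [IsPullback.isoIsPullback_hom_snd, hb2]
      rw [e]
      infer_instance
    have e : pullback.snd l (pullback.fst (pullback.snd s t) (𝒰.f i)) =
        hL.isoPullback.inv ≫ b := by
      rw [IsPullback.isoPullback_inv_snd]
    change IsIso (pullback.snd l (pullback.fst (pullback.snd s t) (𝒰.f i)))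
    rw [e]
    infer_instance
  exact IsPullback.of_iso_pullback ⟨w⟩ (asIso l) hl1 hl2

lemma Fan.exists_chartIncl (F : Fan N) (x : F.toricVariety) :
    ∃ (σ : F.cones) (y : chart σ.1), F.chartIncl σ y = x := by
  obtain ⟨σ, y, h⟩ := (Scheme.IsLocallyDirected.openCover F.diagram).exists_eq x
  exact ⟨σ, y, h⟩

instance (F : Fan N) (σ : F.cones) : IsOpenImmersion (F.chartIncl σ) :=
  inferInstanceAs (IsOpenImmersion (colimit.ι F.diagram σ))

lemma Fan.chartIncl_eq_iff (F : Fan N) {σ τ : F.cones} {x : chart σ.1} {y : chart τ.1}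
    (h : F.chartIncl σ x = F.chartIncl τ y) : ∃ (ρ : F.cones) (h₁ : ρ.1 ≤ σ.1) (h₂ : ρ.1 ≤ τ.1)
      (z : chart ρ.1), chartMap LinearMap.id (MapsCone.of_le h₁) z = x ∧
        chartMap LinearMap.id (MapsCone.of_le h₂) z = y := by
  obtain ⟨ρ, f, g, z, h1, h2⟩ := (Scheme.IsLocallyDirected.ι_eq_ι_iff F.diagram).mp h
  exact ⟨ρ, leOfHom f, leOfHom g, z, h1, h2⟩

lemma chartIncl_toricMap (φ : N →ₗ[ℤ] N') {F : Fan N} {F' : Fan N'} (h : IsFanMap φ F F')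
    (σ : F.cones) (σ' : F'.cones) (hσ : MapsCone φ σ.1 σ'.1) :
    F.chartIncl σ ≫ toricMap φ h = chartMap φ hσ ≫ F'.chartIncl σ' := by
  rw [toricMap, Fan.chartIncl_glue]
  exact chartMap_chartIncl_eq φ F' (σ₁ := ⟨_, _⟩) _ _

/-- The preimage under `U_σ → U_σ'` of the chart of a face of `σ'` is the chart of a face. -/
lemma exists_face_of_chartMap_mem (φ : N →ₗ[ℤ] N') {F : Fan N} {F' : Fan N'} (σ : F.cones)
    (σ' ρ' : F'.cones) (hσ : MapsCone φ σ.1 σ'.1) (hρ : ρ'.1 ≤ σ'.1) (y : chart σ.1)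
    (w : chart ρ'.1) (hy : chartMap LinearMap.id (MapsCone.of_le hρ) w = chartMap φ hσ y) :
    ∃ (ρ : F.cones) (h : ρ.1 ≤ σ.1) (z : chart ρ.1), MapsCone φ ρ.1 ρ'.1 ∧
      chartMap LinearMap.id (MapsCone.of_le h) z = y := by
  obtain ⟨m, hm, hρ'⟩ := F'.isFace_of_le σ'.2 ρ'.2 hρ
  have hm1 : m ∘ₗ φ ∈ semigroup σ.1 := fun x hx => by
    rw [← pairing_baseChange]; exact hm _ (hσ x hx)
  have hf := isFace_cut hm1
  let ρ : F.cones := ⟨_, F.face_mem _ σ.2 _ hf⟩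
  have hρσ : ρ.1 ≤ σ.1 := inf_le_left
  have r1 := range_chartMap (τ := ρ.1) (F.rational _ σ.2) hm1 (fun _ => Iff.rfl)
    (MapsCone.of_le hρσ)
  have r2 := range_chartMap (F'.rational _ σ'.2) hm hρ' (MapsCone.of_le hρ)
  have hy1 : y ∈ Set.range (chartMap LinearMap.id (MapsCone.of_le hρσ)) := by
    have := r2.subset ⟨w, hy⟩
    refine r1.symm.subset ?_
    intro hmem
    apply this
    change AddMonoidAlgebra.mapDomainRingHom ℂ (semigroupMap φ hσ)
      (AddMonoidAlgebra.single (⟨m, hm⟩ : semigroup σ'.1) (1 : ℂ)) ∈ PrimeSpectrum.asIdeal y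
    have e : AddMonoidAlgebra.mapDomainRingHom ℂ (semigroupMap φ hσ)
      (AddMonoidAlgebra.single (⟨m, hm⟩ : semigroup σ'.1) (1 : ℂ)) =
        AddMonoidAlgebra.single (⟨m ∘ₗ φ, hm1⟩ : semigroup σ.1) (1 : ℂ) :=
      AddMonoidAlgebra.mapDomain_single
    rw [e]
    exact hmem
  obtain ⟨z, hz⟩ := hy1
  refine ⟨ρ, hρσ, z, fun x hx => ?_, hz⟩
  rw [hρ', pairing_baseChange]
  exact ⟨hσ _ hx.1, hx.2⟩

/-- A point of `X_F` that `toricMap φ` maps into the chart of `τ` lies in the chart of a cone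
that `φ` maps into `τ`. -/
lemma exists_chart_of_toricMap_mem (φ : N →ₗ[ℤ] N') {F : Fan N} {F' : Fan N'}
    (h : IsFanMap φ F F') (τ : F'.cones) (x : F.toricVariety)
    (hx : toricMap φ h x ∈ Set.range (F'.chartIncl τ)) :
    ∃ (ρ : F.cones) (z : chart ρ.1), MapsCone φ ρ.1 τ.1 ∧ F.chartIncl ρ z = x := by
  obtain ⟨u, hu⟩ := hx
  obtain ⟨σ, y, rfl⟩ := F.exists_chartIncl x
  obtain ⟨σ', hσ', hσσ'⟩ := h σ.1 σ.2
  rw [← Scheme.Hom.comp_apply, chartIncl_toricMap φ h σ ⟨σ', hσ'⟩ hσσ', Scheme.Hom.comp_apply] at hu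
  obtain ⟨ρ', h1, h2, w, hw1, hw2⟩ := F'.chartIncl_eq_iff hu
  obtain ⟨ρ, hρ, z, hz1, hz2⟩ := exists_face_of_chartMap_mem φ σ ⟨σ', hσ'⟩ ρ' hσσ' h2 y w hw2
  refine ⟨ρ, z, fun x hx => h1 (hz1 x hx), ?_⟩
  rw [← hz2, ← Scheme.Hom.comp_apply, F.chartMap_chartIncl _ hρ]


section MonoidAlgebra

variable {S T C : Type} [AddCommMonoid S] [AddCommMonoid T] [AddCommMonoid C]

lemma monoidAlgebra_exists_desc (f : S →+ C) (g : T →+ C) (p : C →+ S) (r : C →+ T)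
    (hpf : ∀ s, p (f s) = s) (hpg : ∀ t, p (g t) = 0) (hrf : ∀ s, r (f s) = 0)
    (hrg : ∀ t, r (g t) = t) {R : Type} [CommRing R] (u : AddMonoidAlgebra ℂ S →+* R)
    (v : AddMonoidAlgebra ℂ T →+* R)
    (huv : u.comp (algebraMap ℂ (AddMonoidAlgebra ℂ S)) =
      v.comp (algebraMap ℂ (AddMonoidAlgebra ℂ T))) :
    ∃ h : AddMonoidAlgebra ℂ C →+* R, h.comp (AddMonoidAlgebra.mapDomainRingHom ℂ f) = u ∧
      h.comp (AddMonoidAlgebra.mapDomainRingHom ℂ g) = v := by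
  have e1 : ∀ x y : S, (AddMonoidAlgebra.single (x + y) 1 : AddMonoidAlgebra ℂ S) =
    AddMonoidAlgebra.single x 1 * AddMonoidAlgebra.single y 1 := by simp
  have e2 : ∀ x y : T, (AddMonoidAlgebra.single (x + y) 1 : AddMonoidAlgebra ℂ T) =
    AddMonoidAlgebra.single x 1 * AddMonoidAlgebra.single y 1 := by simp
  let φ : Multiplicative C →* R :=
    { toFun := fun c => u (AddMonoidAlgebra.single (p c.toAdd) 1) *
          v (AddMonoidAlgebra.single (r c.toAdd) 1)
      map_one' := by simp [← AddMonoidAlgebra.one_def]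
      map_mul' := fun a b => by
        rw [toAdd_mul, map_add, map_add, e1, e2, map_mul, map_mul]
        ring }
  have huv' : ∀ z : ℂ, u (AddMonoidAlgebra.single 0 z) = v (AddMonoidAlgebra.single 0 z) :=
    fun z => by simpa using congrArg (fun h => h z) huv
  let h : AddMonoidAlgebra ℂ C →+* R := AddMonoidAlgebra.liftNCRingHom
    (u.comp (algebraMap ℂ (AddMonoidAlgebra ℂ S))) φ (fun _ _ => Commute.all _ _)
  have hs : ∀ (c : C) (z : ℂ), h (AddMonoidAlgebra.single c z) =
      u (AddMonoidAlgebra.single 0 z) * (u (AddMonoidAlgebra.single (p c) 1) *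
        v (AddMonoidAlgebra.single (r c) 1)) := by
    intro c z
    exact (AddMonoidAlgebra.liftNC_single _ _ _ _)
  refine ⟨h, ?_, ?_⟩
  · refine AddMonoidAlgebra.ringHom_ext (fun z => ?_) (fun x => ?_)
    · simp [hs, ← AddMonoidAlgebra.one_def]
    · simp [hs, hpf, hrf, ← AddMonoidAlgebra.one_def]
  · refine AddMonoidAlgebra.ringHom_ext (fun z => ?_) (fun x => ?_)
    · simp [hs, huv', ← AddMonoidAlgebra.one_def]
    · simp [hs, hpg, hrg, ← AddMonoidAlgebra.one_def]

lemma monoidAlgebra_hom_ext (f : S →+ C) (g : T →+ C) (p : C →+ S) (r : C →+ T)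
    (hc : ∀ c, f (p c) + g (r c) = c) {R : Type} [CommRing R]
    {h h' : AddMonoidAlgebra ℂ C →+* R}
    (hf : h.comp (AddMonoidAlgebra.mapDomainRingHom ℂ f) =
      h'.comp (AddMonoidAlgebra.mapDomainRingHom ℂ f))
    (hg : h.comp (AddMonoidAlgebra.mapDomainRingHom ℂ g) =
      h'.comp (AddMonoidAlgebra.mapDomainRingHom ℂ g)) : h = h' := by
  have hf' : ∀ (s : S) (z : ℂ), h (AddMonoidAlgebra.single (f s) z) =
      h' (AddMonoidAlgebra.single (f s) z) := fun s z => by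
    simpa using congrArg (fun k => k (AddMonoidAlgebra.single s z)) hf
  have hg' : ∀ (t : T) (z : ℂ), h (AddMonoidAlgebra.single (g t) z) =
      h' (AddMonoidAlgebra.single (g t) z) := fun t z => by
    simpa using congrArg (fun k => k (AddMonoidAlgebra.single t z)) hg
  have e : ∀ (c : C) (z : ℂ), (AddMonoidAlgebra.single c z : AddMonoidAlgebra ℂ C) =
      AddMonoidAlgebra.single (f (p c)) z * AddMonoidAlgebra.single (g (r c)) 1 := by
    intro c z
    rw [AddMonoidAlgebra.single_mul_single, hc, mul_one]
  refine AddMonoidAlgebra.ringHom_ext (fun z => ?_) (fun x => ?_)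
  · rw [e, map_mul, map_mul, hf', hg']
  · rw [e, map_mul, map_mul, hf', hg']

/-- The monoid algebra of a direct sum of monoids is the tensor product. -/
lemma isPushout_monoidAlgebra (f : S →+ C) (g : T →+ C) (p : C →+ S) (r : C →+ T)
    (hpf : ∀ s, p (f s) = s) (hpg : ∀ t, p (g t) = 0) (hrf : ∀ s, r (f s) = 0)
    (hrg : ∀ t, r (g t) = t) (hc : ∀ c, f (p c) + g (r c) = c) :
    IsPushout (CommRingCat.ofHom (algebraMap ℂ (AddMonoidAlgebra ℂ S)))
      (CommRingCat.ofHom (algebraMap ℂ (AddMonoidAlgebra ℂ T)))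
      (CommRingCat.ofHom (AddMonoidAlgebra.mapDomainRingHom ℂ f))
      (CommRingCat.ofHom (AddMonoidAlgebra.mapDomainRingHom ℂ g)) := by
  have hw : CommRingCat.ofHom (algebraMap ℂ (AddMonoidAlgebra ℂ S)) ≫
      CommRingCat.ofHom (AddMonoidAlgebra.mapDomainRingHom ℂ f) =
      CommRingCat.ofHom (algebraMap ℂ (AddMonoidAlgebra ℂ T)) ≫
      CommRingCat.ofHom (AddMonoidAlgebra.mapDomainRingHom ℂ g) := by
    ext r
    simp
  have H : ∀ s : PushoutCocone (CommRingCat.ofHom (algebraMap ℂ (AddMonoidAlgebra ℂ S)))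
      (CommRingCat.ofHom (algebraMap ℂ (AddMonoidAlgebra ℂ T))),
      ∃ h : AddMonoidAlgebra ℂ C →+* s.pt,
        h.comp (AddMonoidAlgebra.mapDomainRingHom ℂ f) = s.inl.hom ∧
        h.comp (AddMonoidAlgebra.mapDomainRingHom ℂ g) = s.inr.hom := fun s =>
    monoidAlgebra_exists_desc f g p r hpf hpg hrf hrg s.inl.hom s.inr.hom
      (congrArg CommRingCat.Hom.hom s.condition)
  choose d hd1 hd2 using H
  refine ⟨⟨hw⟩, ⟨PushoutCocone.IsColimit.mk hw (fun s => CommRingCat.ofHom (d s))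
    (fun s => CommRingCat.hom_ext (hd1 s)) (fun s => CommRingCat.hom_ext (hd2 s)) ?_⟩⟩
  intro s m h1 h2
  refine CommRingCat.hom_ext (monoidAlgebra_hom_ext f g p r hc ?_ ?_)
  · exact (congrArg CommRingCat.Hom.hom h1).trans (hd1 s).symm
  · exact (congrArg CommRingCat.Hom.hom h2).trans (hd2 s).symm

end MonoidAlgebra

/-- `p : E → B` is a (Zariski) locally trivial fibre bundle of `ℂ`-schemes with fibre `X`:
every point of `B` has an open neighbourhood `U` with an isomorphism `p⁻¹(U) ≅ U × X` over `U`. -/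
def IsFibreBundle {E B X : Scheme.{0}} (p : E ⟶ B) (sB : B ⟶ Spec (CommRingCat.of ℂ))
    (sX : X ⟶ Spec (CommRingCat.of ℂ)) : Prop :=
  ∀ b : B, ∃ U : B.Opens, b ∈ U ∧
    ∃ e : (p ⁻¹ᵁ U).toScheme ≅ pullback (U.ι ≫ sB) sX,
      e.hom ≫ pullback.fst (U.ι ≫ sB) sX = p ∣_ U

lemma IsFibreBundle.of_isPullback {E B X : Scheme.{0}} {p : E ⟶ B}
    {sB : B ⟶ Spec (CommRingCat.of ℂ)} {sX : X ⟶ Spec (CommRingCat.of ℂ)}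
    (H : ∀ b : B, ∃ (V W : Scheme.{0}) (j : V ⟶ B) (k : W ⟶ E) (a : W ⟶ V) (q : W ⟶ X),
      IsOpenImmersion j ∧ b ∈ Set.range j ∧ IsPullback a k j p ∧
        IsPullback a q (j ≫ sB) sX) : IsFibreBundle p sB sX := by
  intro b
  obtain ⟨V, W, j, k, a, q, hj, hb, h₁, h₂⟩ := H b
  refine ⟨j.opensRange, hb, ?_⟩
  have hi : j.isoOpensRange.hom ≫ j.opensRange.ι = j := by simp
  have h₁' : IsPullback (a ≫ j.isoOpensRange.hom) k j.opensRange.ι p := by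
    refine h₁.of_iso (Iso.refl _) j.isoOpensRange (Iso.refl _) (Iso.refl _) ?_ ?_ ?_ ?_ <;> simp
  have h₂' : IsPullback (a ≫ j.isoOpensRange.hom) q (j.opensRange.ι ≫ sB) sX := by
    refine h₂.of_iso (Iso.refl _) j.isoOpensRange (Iso.refl _) (Iso.refl _) ?_ ?_ ?_ ?_ <;> simp
  have h₃ := (isPullback_morphismRestrict p j.opensRange)
  refine ⟨(h₃.isoIsPullback _ _ h₁') ≪≫ h₂'.isoPullback, ?_⟩
  rw [Iso.trans_hom, Category.assoc, IsPullback.isoPullback_hom_fst,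
    IsPullback.isoIsPullback_hom_fst]

lemma chartMap_algebraMap (φ : N →ₗ[ℤ] N') {σ : PointedCone ℝ (RealSpace N)}
    {σ' : PointedCone ℝ (RealSpace N')} (h : MapsCone φ σ σ') :
    chartMap φ h ≫ Spec.map (CommRingCat.ofHom (algebraMap ℂ (chartRing σ'))) =
      Spec.map (CommRingCat.ofHom (algebraMap ℂ (chartRing σ))) := by
  rw [chartMap, ← Spec.map_comp, ← CommRingCat.ofHom_comp]
  congr 2
  ext r
  simp

lemma Fan.chartIncl_structureMap (F : Fan N) (σ : F.cones) :
    F.chartIncl σ ≫ F.structureMap =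
      Spec.map (CommRingCat.ofHom (algebraMap ℂ (chartRing σ.1))) :=
  F.chartIncl_glue _ _ _

lemma toricMap_structureMap (φ : N →ₗ[ℤ] N') {F : Fan N} {F' : Fan N'} (h : IsFanMap φ F F') :
    toricMap φ h ≫ F'.structureMap = F.structureMap := by
  refine F.hom_ext fun σ => ?_
  obtain ⟨σ', hσ', hh⟩ := h σ.1 σ.2
  rw [← Category.assoc, chartIncl_toricMap φ h σ ⟨σ', hσ'⟩ hh, Category.assoc,
    Fan.chartIncl_structureMap, Fan.chartIncl_structureMap, chartMap_algebraMap]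

/-- The subfan of the cones that `φ` maps into the cone `σ`. -/
def Fan.preimage (F : Fan N) (φ : N →ₗ[ℤ] N') (σ : PointedCone ℝ (RealSpace N')) : Fan N where
  cones := {C | C ∈ F.cones ∧ MapsCone φ C σ}
  finite := F.finite.subset fun _ h => h.1
  bot_mem := ⟨F.bot_mem, fun x hx => by
    rw [Submodule.mem_bot] at hx
    rw [hx, map_zero]
    exact zero_mem σ⟩
  rational := fun C h => F.rational C h.1
  salient := fun C h => F.salient C h.1
  face_mem := fun C h D hD => ⟨F.face_mem C h.1 D hD, fun x hx => by
    obtain ⟨m, _, hm⟩ := hD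
    exact h.2 x ((hm x).mp hx).1⟩
  inf_isFace := fun C h D h' => F.inf_isFace C h.1 D h'.1

lemma isFanMap_preimage (F : Fan N) (φ : N →ₗ[ℤ] N') (σ : PointedCone ℝ (RealSpace N')) :
    IsFanMap LinearMap.id (F.preimage φ σ) F :=
  fun C h => ⟨C, h.1, MapsCone.of_le le_rfl⟩

/-- The open cover of `X_F` by its charts. -/
def Fan.openCover (F : Fan N) : F.toricVariety.OpenCover :=
  Scheme.IsLocallyDirected.openCover F.diagram

lemma chartIncl_preimage (F : Fan N) (φ : N →ₗ[ℤ] N') (σ : PointedCone ℝ (RealSpace N'))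
    (C : (F.preimage φ σ).cones) :
    (F.preimage φ σ).chartIncl C ≫ toricMap LinearMap.id (isFanMap_preimage F φ σ) =
      F.chartIncl ⟨C.1, C.2.1⟩ := by
  rw [chartIncl_toricMap _ _ C ⟨C.1, C.2.1⟩ (MapsCone.of_le le_rfl), chartMap_id,
    Category.id_comp]

instance (F : Fan N) (φ : N →ₗ[ℤ] N') (σ : PointedCone ℝ (RealSpace N')) :
    IsOpenImmersion (toricMap LinearMap.id (isFanMap_preimage F φ σ)) := by
  refine IsOpenImmersion.of_openCover_source _ (F.preimage φ σ).openCover ?_ ?_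
  · intro x y hxy
    obtain ⟨C, x, rfl⟩ := (F.preimage φ σ).exists_chartIncl x
    obtain ⟨D, y, rfl⟩ := (F.preimage φ σ).exists_chartIncl y
    rw [← Scheme.Hom.comp_apply, ← Scheme.Hom.comp_apply, chartIncl_preimage,
      chartIncl_preimage] at hxy
    obtain ⟨ρ, h1, h2, z, hz1, hz2⟩ := F.chartIncl_eq_iff hxy
    let ρ' : (F.preimage φ σ).cones := ⟨ρ.1, ρ.2, fun x hx => C.2.2 x (h1 hx)⟩
    have e1 := (F.preimage φ σ).chartMap_chartIncl (σ := ρ') (τ := C) (MapsCone.of_le h1) h1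
    have e2 := (F.preimage φ σ).chartMap_chartIncl (σ := ρ') (τ := D) (MapsCone.of_le h2) h2
    rw [← hz1, ← hz2]
    exact (congrArg (fun f => f z) e1).trans (congrArg (fun f => f z) e2).symm
  · have H : ∀ C : (F.preimage φ σ).cones, IsOpenImmersion ((F.preimage φ σ).chartIncl C ≫
        toricMap LinearMap.id (isFanMap_preimage F φ σ)) := by
      intro C
      rw [chartIncl_preimage]
      infer_instance
    exact H

/-- The morphism from the subfan to the chart `U_σ`. -/
def preimageToChart (F : Fan N) (φ : N →ₗ[ℤ] N') (σ : PointedCone ℝ (RealSpace N')) :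
    (F.preimage φ σ).toricVariety ⟶ chart σ :=
  (F.preimage φ σ).glue (fun C => chartMap φ C.2.2) (fun _ _ _ => chartMap_id_comp _ _ _)

/-- The preimage of a chart `U_σ` under a toric morphism is the toric variety of the subfan of
the cones mapped into `σ`. -/
lemma isPullback_preimage {F : Fan N} {F' : Fan N'} (φ : N →ₗ[ℤ] N') (h : IsFanMap φ F F')
    (σ : F'.cones) :
    IsPullback (preimageToChart F φ σ.1) (toricMap LinearMap.id (isFanMap_preimage F φ σ.1))
      (F'.chartIncl σ) (toricMap φ h) := by
  have hc : toricMap LinearMap.id (isFanMap_preimage F φ σ.1) ≫ toricMap φ h =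
      preimageToChart F φ σ.1 ≫ F'.chartIncl σ := by
    refine Fan.hom_ext _ fun C => ?_
    rw [← Category.assoc, chartIncl_preimage, ← Category.assoc, preimageToChart,
      Fan.chartIncl_glue]
    exact chartIncl_toricMap φ h ⟨C.1, C.2.1⟩ σ C.2.2
  refine IsOpenImmersion.isPullback _ _ _ _ hc ?_
  ext x
  constructor
  · intro hx
    obtain ⟨ρ, z, hρ, rfl⟩ := exists_chart_of_toricMap_mem φ h σ x hx
    refine ⟨(F.preimage φ σ.1).chartIncl ⟨ρ.1, ρ.2, hρ⟩ z, ?_⟩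
    rw [← Scheme.Hom.comp_apply, chartIncl_preimage]
  · rintro ⟨w, rfl⟩
    refine ⟨preimageToChart F φ σ.1 w, ?_⟩
    rw [← Scheme.Hom.comp_apply, ← hc, Scheme.Hom.comp_apply]

/-- If `C` is the largest cone that is mapped into `τ`, the preimage of `U_τ` is `U_C`. -/
lemma isPullback_chart {F : Fan N} {F' : Fan N'} (φ : N →ₗ[ℤ] N') (h : IsFanMap φ F F')
    (C : F.cones) (τ : F'.cones) (hC : MapsCone φ C.1 τ.1)
    (hmax : ∀ D ∈ F.cones, MapsCone φ D τ.1 → D ≤ C.1) :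
    IsPullback (F.chartIncl C) (chartMap φ hC) (toricMap φ h) (F'.chartIncl τ) := by
  have hc := chartIncl_toricMap φ h C τ hC
  refine (IsOpenImmersion.isPullback _ _ _ _ hc ?_).flip
  ext x
  constructor
  · intro hx
    obtain ⟨ρ, z, hρ, rfl⟩ := exists_chart_of_toricMap_mem φ h τ x hx
    refine ⟨chartMap LinearMap.id (MapsCone.of_le (hmax _ ρ.2 hρ)) z, ?_⟩
    rw [← Scheme.Hom.comp_apply, F.chartMap_chartIncl _ (hmax _ ρ.2 hρ)]
  · rintro ⟨w, rfl⟩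
    refine ⟨chartMap φ hC w, ?_⟩
    rw [← Scheme.Hom.comp_apply, ← hc, Scheme.Hom.comp_apply]

/-! ### Twisted products of fans -/

section Twisted

variable {NB NF : Type} [AddCommGroup NB] [AddCommGroup NF]

variable (NB NF) in
/-- The embedding `(N_B)_ℝ → N_ℝ`, `x ↦ (x, 0)`, for `N = N_B × N_F`. -/
def inlR : RealSpace NB →ₗ[ℝ] RealSpace (NB × NF) := (LinearMap.inl ℤ NB NF).baseChange ℝ

variable (NB NF) in
/-- The embedding `(N_F)_ℝ → N_ℝ`, `y ↦ (0, y)`. -/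
def inrR : RealSpace NF →ₗ[ℝ] RealSpace (NB × NF) := (LinearMap.inr ℤ NB NF).baseChange ℝ

variable (NB NF) in
/-- The projection `N_ℝ → (N_B)_ℝ`. -/
def fstR : RealSpace (NB × NF) →ₗ[ℝ] RealSpace NB := (LinearMap.fst ℤ NB NF).baseChange ℝ

variable (NB NF) in
/-- The projection `N_ℝ → (N_F)_ℝ`. -/
def sndR : RealSpace (NB × NF) →ₗ[ℝ] RealSpace NF := (LinearMap.snd ℤ NB NF).baseChange ℝ

@[simp] lemma fstR_inlR (x : RealSpace NB) : fstR NB NF (inlR NB NF x) = x := by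
  rw [fstR, inlR, ← LinearMap.comp_apply, ← LinearMap.baseChange_comp, LinearMap.fst_comp_inl,
    LinearMap.baseChange_id, LinearMap.id_apply]

@[simp] lemma sndR_inrR (y : RealSpace NF) : sndR NB NF (inrR NB NF y) = y := by
  rw [sndR, inrR, ← LinearMap.comp_apply, ← LinearMap.baseChange_comp, LinearMap.snd_comp_inr,
    LinearMap.baseChange_id, LinearMap.id_apply]

@[simp] lemma fstR_inrR (y : RealSpace NF) : fstR NB NF (inrR NB NF y) = 0 := by
  rw [fstR, inrR, ← LinearMap.comp_apply, ← LinearMap.baseChange_comp, LinearMap.fst_comp_inr,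
    LinearMap.baseChange_zero, LinearMap.zero_apply]

@[simp] lemma sndR_inlR (x : RealSpace NB) : sndR NB NF (inlR NB NF x) = 0 := by
  rw [sndR, inlR, ← LinearMap.comp_apply, ← LinearMap.baseChange_comp, LinearMap.snd_comp_inl,
    LinearMap.baseChange_zero, LinearMap.zero_apply]

lemma inlR_fstR_add (z : RealSpace (NB × NF)) :
    inlR NB NF (fstR NB NF z) + inrR NB NF (sndR NB NF z) = z := by
  induction z using TensorProduct.induction_on with
  | zero => simp
  | tmul r v => simp [inlR, fstR, inrR, sndR, ← TensorProduct.tmul_add]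
  | add a b ha hb =>
    rw [map_add, map_add, map_add, map_add, add_add_add_comm, ha, hb]

variable (FB : Fan NB) (FF : Fan NF)

variable (NF) in
/-- A twisting map: a map `Φ : |Σ_B| → (N_F)_ℝ` whose restriction to every cone of `Σ_B` is
linear and integral, i.e. agrees with a homomorphism of lattices `N_B → N_F`.
(Being linear on each of finitely many closed cones, `Φ` is automatically continuous.) -/
structure TwistingMap where
  toFun : FB.support → RealSpace NF
  conewise_linear : ∀ σ ∈ FB.cones, ∃ L : NB →ₗ[ℤ] NF,
    ∀ x : FB.support, x.1 ∈ σ → toFun x = L.baseChange ℝ x.1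

variable {FB} (Φ : TwistingMap NF FB)

/-- The graph `{(x, Φ(x)) | x ∈ σ}` of `Φ` over a cone `σ` of `Σ_B`. -/
def graphCone (σ : FB.cones) : PointedCone ℝ (RealSpace (NB × NF)) where
  carrier := {z | ∃ x : FB.support, x.1 ∈ σ.1 ∧ z = inlR NB NF x.1 + inrR NB NF (Φ.toFun x)}
  zero_mem' := by
    obtain ⟨L, hL⟩ := Φ.conewise_linear σ.1 σ.2
    refine ⟨⟨0, Fan.mem_support σ.2 (zero_mem _)⟩, zero_mem _, ?_⟩
    rw [hL _ (zero_mem _)]; simp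
  add_mem' := by
    obtain ⟨L, hL⟩ := Φ.conewise_linear σ.1 σ.2
    rintro _ _ ⟨x, hx, rfl⟩ ⟨y, hy, rfl⟩
    refine ⟨⟨x.1 + y.1, Fan.mem_support σ.2 (add_mem hx hy)⟩, add_mem hx hy, ?_⟩
    rw [hL _ hx, hL _ hy, hL _ (add_mem hx hy)]
    simp only [map_add]
    abel
  smul_mem' := by
    obtain ⟨L, hL⟩ := Φ.conewise_linear σ.1 σ.2
    rintro c _ ⟨x, hx, rfl⟩
    have hc : (c : ℝ) • x.1 ∈ σ.1 := Submodule.smul_mem σ.1 c hx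
    refine ⟨⟨(c : ℝ) • x.1, Fan.mem_support σ.2 hc⟩, hc, ?_⟩
    rw [hL _ hx, hL _ hc]
    change (c : ℝ) • (inlR NB NF x.1 + inrR NB NF (L.baseChange ℝ x.1)) = _
    simp only [map_smul, smul_add]

/-- The cone `σ̃ + τ` of the twisted product, where `σ̃` is the graph of `Φ` over `σ`. -/
def twistedCone (σ : FB.cones) (τ : PointedCone ℝ (RealSpace NF)) :
    PointedCone ℝ (RealSpace (NB × NF)) :=
  graphCone Φ σ ⊔ PointedCone.map (inrR NB NF) τ

lemma mem_twistedCone {σ : FB.cones} {τ : PointedCone ℝ (RealSpace NF)} {L : NB →ₗ[ℤ] NF}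
    (hL : ∀ x : FB.support, x.1 ∈ σ.1 → Φ.toFun x = L.baseChange ℝ x.1)
    {z : RealSpace (NB × NF)} :
    z ∈ twistedCone Φ σ τ ↔
      fstR NB NF z ∈ σ.1 ∧ sndR NB NF z - L.baseChange ℝ (fstR NB NF z) ∈ τ := by
  rw [twistedCone, Submodule.mem_sup]
  constructor
  · rintro ⟨_, ⟨x, hx, rfl⟩, _, ⟨y, hy, rfl⟩, rfl⟩
    rw [hL x hx]
    change _ ∈ _ ∧ sndR NB NF (_ + inrR NB NF y) -
      L.baseChange ℝ (fstR NB NF (_ + inrR NB NF y)) ∈ _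
    refine ⟨?_, ?_⟩
    · change fstR NB NF (_ + inrR NB NF y) ∈ _
      simpa using hx
    · simpa using hy
  · rintro ⟨h₁, h₂⟩
    refine ⟨_, ⟨⟨_, Fan.mem_support σ.2 h₁⟩, h₁, rfl⟩, _, ⟨_, h₂, rfl⟩, ?_⟩
    rw [hL _ h₁]
    change _ + inrR NB NF _ = _
    conv_rhs => rw [← inlR_fstR_add z]
    rw [map_sub]
    abel

lemma isFace_twistedCone {σ σ' : FB.cones} (hσ : IsFace σ'.1 σ.1)
    {τ τ' : PointedCone ℝ (RealSpace NF)} (hτ : IsFace τ' τ) :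
    IsFace (twistedCone Φ σ' τ') (twistedCone Φ σ τ) := by
  obtain ⟨L, hL⟩ := Φ.conewise_linear σ.1 σ.2
  obtain ⟨m, hm, hσ'⟩ := hσ
  obtain ⟨n, hn, hτ'⟩ := hτ
  have hL' : ∀ x : FB.support, x.1 ∈ σ'.1 → Φ.toFun x = L.baseChange ℝ x.1 :=
    fun x hx => hL x ((hσ' x.1).mp hx).1
  have key : ∀ z : RealSpace (NB × NF),
      pairing (m ∘ₗ LinearMap.fst ℤ NB NF + n ∘ₗ (LinearMap.snd ℤ NB NF -
        L ∘ₗ LinearMap.fst ℤ NB NF)) z = pairing m (fstR NB NF z) +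
        pairing n (sndR NB NF z - L.baseChange ℝ (fstR NB NF z)) := by
    intro z
    rw [pairing_add, ← pairing_baseChange, ← pairing_baseChange, LinearMap.baseChange_sub,
      LinearMap.baseChange_comp]
    rfl
  refine ⟨m ∘ₗ LinearMap.fst ℤ NB NF + n ∘ₗ (LinearMap.snd ℤ NB NF -
    L ∘ₗ LinearMap.fst ℤ NB NF), fun z hz => ?_, fun z => ?_⟩
  · rw [mem_twistedCone Φ hL] at hz
    rw [key]
    exact add_nonneg (hm _ hz.1) (hn _ hz.2)
  · rw [mem_twistedCone Φ hL, mem_twistedCone Φ hL', key, hσ', hτ']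
    constructor
    · rintro ⟨⟨h1, h2⟩, h3, h4⟩
      exact ⟨⟨h1, h3⟩, by rw [h2, h4, add_zero]⟩
    · rintro ⟨⟨h1, h3⟩, h⟩
      have := hm _ h1
      have := hn _ h3
      exact ⟨⟨h1, by linarith⟩, h3, by linarith⟩

/-- The twisted product `Σ_B ⋉_Φ Σ_F`: the fan in `N = N_B × N_F` with the cones `σ̃ + τ` for
`σ ∈ Σ_B` and `τ ∈ Σ_F`. -/
def twistedProduct : Fan (NB × NF) where
  cones := {C | ∃ σ : FB.cones, ∃ τ ∈ FF.cones, C = twistedCone Φ σ τ}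
  finite := by
    have h1 := FB.finite.to_subtype
    have h2 := FF.finite.to_subtype
    refine (Set.finite_range (fun p : FB.cones × FF.cones => twistedCone Φ p.1 p.2.1)).subset ?_
    rintro _ ⟨σ, τ, hτ, rfl⟩
    exact ⟨(σ, ⟨τ, hτ⟩), rfl⟩
  bot_mem := by
    refine ⟨⟨⊥, FB.bot_mem⟩, ⊥, FF.bot_mem, ?_⟩
    obtain ⟨L, hL⟩ := Φ.conewise_linear ⊥ FB.bot_mem
    ext z
    rw [mem_twistedCone Φ (σ := ⟨⊥, FB.bot_mem⟩) hL]
    constructor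
    · intro hz
      rw [Submodule.mem_bot] at hz
      subst hz
      simp
    · rintro ⟨h1, h2⟩
      rw [Submodule.mem_bot] at h1 h2
      rw [h1, map_zero, sub_zero] at h2
      rw [Submodule.mem_bot, ← inlR_fstR_add z, h1, h2, map_zero, map_zero, add_zero]
  rational := by
    rintro _ ⟨σ, τ, hτ, rfl⟩
    obtain ⟨L, hL⟩ := Φ.conewise_linear σ.1 σ.2
    have h : twistedCone Φ σ τ = PointedCone.map
        ((LinearMap.inl ℤ NB NF + LinearMap.inr ℤ NB NF ∘ₗ L).baseChange ℝ) σ.1 ⊔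
        PointedCone.map (inrR NB NF) τ := by
      rw [twistedCone]
      congr 1
      have e : ∀ x, (LinearMap.inl ℤ NB NF + LinearMap.inr ℤ NB NF ∘ₗ L).baseChange ℝ x =
          inlR NB NF x + inrR NB NF (L.baseChange ℝ x) := by
        intro x
        rw [LinearMap.baseChange_add, LinearMap.baseChange_comp]
        rfl
      ext z
      rw [PointedCone.mem_map]
      constructor
      · rintro ⟨x, hx, rfl⟩
        exact ⟨x.1, hx, by rw [e, hL x hx]⟩
      · rintro ⟨x, hx, rfl⟩
        exact ⟨⟨x, Fan.mem_support σ.2 hx⟩, hx, by rw [e, hL _ hx]⟩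
    rw [h]
    exact ((FB.rational _ σ.2).map _).sup ((FF.rational _ hτ).map _)
  salient := by
    rintro _ ⟨σ, τ, hτ, rfl⟩ z hz hz0 hneg
    obtain ⟨L, hL⟩ := Φ.conewise_linear σ.1 σ.2
    replace hz : z ∈ twistedCone Φ σ τ := hz
    replace hneg : -z ∈ twistedCone Φ σ τ := hneg
    rw [mem_twistedCone Φ hL] at hz hneg
    have h1 : fstR NB NF z = 0 := by
      by_contra h
      exact FB.salient _ σ.2 _ hz.1 h (by simpa using hneg.1)
    have h2 : sndR NB NF z = 0 := by
      by_contra h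
      refine FF.salient _ hτ (sndR NB NF z) ?_ h ?_
      · have := hz.2
        rw [h1, map_zero, sub_zero] at this
        exact this
      · have := hneg.2
        rw [map_neg, map_neg, h1, neg_zero, map_zero, sub_zero] at this
        exact this
    exact hz0 (by rw [← inlR_fstR_add z, h1, h2, map_zero, map_zero, add_zero])
  face_mem := by
    rintro _ ⟨σ, τ, hτ, rfl⟩ C ⟨m, hm, hC⟩
    obtain ⟨L, hL⟩ := Φ.conewise_linear σ.1 σ.2
    have key : ∀ z : RealSpace (NB × NF), pairing m z =
        pairing (m ∘ₗ (LinearMap.inl ℤ NB NF + LinearMap.inr ℤ NB NF ∘ₗ L)) (fstR NB NF z) +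
        pairing (m ∘ₗ LinearMap.inr ℤ NB NF)
          (sndR NB NF z - L.baseChange ℝ (fstR NB NF z)) := by
      intro z
      rw [← pairing_baseChange, ← pairing_baseChange, ← map_add, LinearMap.baseChange_add,
        LinearMap.baseChange_comp, map_sub]
      refine congrArg _ ?_
      conv_lhs => rw [← inlR_fstR_add z]
      simp only [LinearMap.add_apply, LinearMap.comp_apply, inlR, inrR]
      abel
    have hmB : ∀ x ∈ σ.1,
        0 ≤ pairing (m ∘ₗ (LinearMap.inl ℤ NB NF + LinearMap.inr ℤ NB NF ∘ₗ L)) x := by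
      intro x hx
      have := hm (inlR NB NF x + inrR NB NF (L.baseChange ℝ x)) (by
        rw [mem_twistedCone Φ hL]; simpa using hx)
      rw [key] at this
      simpa using this
    have hmF : ∀ y ∈ τ, 0 ≤ pairing (m ∘ₗ LinearMap.inr ℤ NB NF) y := by
      intro y hy
      have := hm (inrR NB NF y) (by rw [mem_twistedCone Φ hL]; simpa using hy)
      rw [key] at this
      simpa using this
    have fB := isFace_cut hmB
    have fF := isFace_cut hmF
    refine ⟨⟨_, FB.face_mem _ σ.2 _ fB⟩, _, FF.face_mem _ hτ _ fF, ?_⟩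
    ext z
    rw [hC, mem_twistedCone Φ hL, mem_twistedCone Φ
      (σ := ⟨_, FB.face_mem _ σ.2 _ fB⟩) (L := L) (fun x hx => hL x hx.1), key]
    constructor
    · rintro ⟨⟨h1, h2⟩, h3⟩
      have := hmB _ h1
      have := hmF _ h2
      exact ⟨⟨h1, show _ = _ by linarith⟩, ⟨h2, show _ = _ by linarith⟩⟩
    · rintro ⟨⟨h1, h3⟩, ⟨h2, h4⟩⟩
      refine ⟨⟨h1, h2⟩, ?_⟩
      have h3 : pairing _ _ = 0 := h3
      have h4 : pairing _ _ = 0 := h4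
      rw [h3, h4, add_zero]
  inf_isFace := by
    rintro _ ⟨σ, τ, hτ, rfl⟩ _ ⟨σ', τ', hτ', rfl⟩
    have h : twistedCone Φ σ τ ⊓ twistedCone Φ σ' τ' =
        twistedCone Φ ⟨σ.1 ⊓ σ'.1, FB.inf_mem σ.2 σ'.2⟩ (τ ⊓ τ') := by
      obtain ⟨L, hL⟩ := Φ.conewise_linear σ.1 σ.2
      obtain ⟨L', hL'⟩ := Φ.conewise_linear σ'.1 σ'.2
      ext z
      rw [Submodule.mem_inf, mem_twistedCone Φ hL, mem_twistedCone Φ hL',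
        mem_twistedCone Φ (σ := ⟨σ.1 ⊓ σ'.1, FB.inf_mem σ.2 σ'.2⟩) (L := L)
          (fun x hx => hL x hx.1)]
      have e : fstR NB NF z ∈ σ.1 → fstR NB NF z ∈ σ'.1 →
          L.baseChange ℝ (fstR NB NF z) = L'.baseChange ℝ (fstR NB NF z) := fun h1 h2 =>
        (hL ⟨_, Fan.mem_support σ.2 h1⟩ h1).symm.trans (hL' ⟨_, Fan.mem_support σ.2 h1⟩ h2)
      constructor
      · rintro ⟨⟨h1, h2⟩, h3, h4⟩
        exact ⟨⟨h1, h3⟩, h2, by rw [e h1 h3]; exact h4⟩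
      · rintro ⟨⟨h1, h3⟩, h2, h4⟩
        exact ⟨⟨h1, h2⟩, h3, by rw [← e h1 h3]; exact h4⟩
    rw [h]
    exact isFace_twistedCone Φ (FB.inf_isFace _ σ.2 _ σ'.2) (FF.inf_isFace _ hτ _ hτ')

/-- The projection `N → N_B` is a map of fans `Σ_B ⋉_Φ Σ_F → Σ_B`. -/
lemma isFanMap_fst : IsFanMap (LinearMap.fst ℤ NB NF) (twistedProduct FF Φ) FB := by
  rintro _ ⟨σ, τ, hτ, rfl⟩
  obtain ⟨L, hL⟩ := Φ.conewise_linear σ.1 σ.2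
  exact ⟨σ.1, σ.2, fun z hz => ((mem_twistedCone Φ hL).mp hz).1⟩

/-- `U_{σ̃ + τ} = U_σ × U_τ`. -/
lemma isPullback_twistedCone (σ : FB.cones) (τ : PointedCone ℝ (RealSpace NF))
    {L : NB →ₗ[ℤ] NF} (hL : ∀ x : FB.support, x.1 ∈ σ.1 → Φ.toFun x = L.baseChange ℝ x.1)
    (h₁ : MapsCone (LinearMap.fst ℤ NB NF) (twistedCone Φ σ τ) σ.1)
    (h₂ : MapsCone (LinearMap.snd ℤ NB NF - L ∘ₗ LinearMap.fst ℤ NB NF) (twistedCone Φ σ τ) τ) :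
    IsPullback (chartMap _ h₁) (chartMap _ h₂)
      (Spec.map (CommRingCat.ofHom (algebraMap ℂ (chartRing σ.1))))
      (Spec.map (CommRingCat.ofHom (algebraMap ℂ (chartRing τ)))) := by
  have g₁ : MapsCone (LinearMap.inl ℤ NB NF + LinearMap.inr ℤ NB NF ∘ₗ L) σ.1
      (twistedCone Φ σ τ) := by
    intro x hx
    have e : (LinearMap.inl ℤ NB NF + LinearMap.inr ℤ NB NF ∘ₗ L).baseChange ℝ x =
        inlR NB NF x + inrR NB NF (L.baseChange ℝ x) := by
      rw [LinearMap.baseChange_add, LinearMap.baseChange_comp]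
      rfl
    rw [e, mem_twistedCone Φ hL]
    simpa using hx
  have g₂ : MapsCone (LinearMap.inr ℤ NB NF) τ (twistedCone Φ σ τ) := by
    intro y hy
    change inrR NB NF y ∈ _
    rw [mem_twistedCone Φ hL]
    simpa using hy
  refine isPullback_SpecMap_of_isPushout _ _ _ _ (isPushout_monoidAlgebra
    (semigroupMap _ h₁) (semigroupMap _ h₂) (semigroupMap _ g₁) (semigroupMap _ g₂)
    ?_ ?_ ?_ ?_ ?_)
  · intro m
    refine Subtype.ext (LinearMap.ext fun v => ?_)
    simp [semigroupMap]
  · intro m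
    refine Subtype.ext (LinearMap.ext fun v => ?_)
    simp [semigroupMap]
  · intro m
    refine Subtype.ext (LinearMap.ext fun v => ?_)
    simp [semigroupMap]
  · intro m
    refine Subtype.ext (LinearMap.ext fun v => ?_)
    simp [semigroupMap]
  · intro m
    refine Subtype.ext (LinearMap.ext fun v => ?_)
    change m.1 _ + m.1 _ = m.1 v
    rw [← map_add]
    congr 1
    ext <;> simp

/-- The projection of a twisted product is a locally trivial bundle with fibre `X_{Σ_F}`. -/
theorem isFibreBundle_twistedProduct :
    IsFibreBundle (toricMap (LinearMap.fst ℤ NB NF) (isFanMap_fst FF Φ))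
      FB.structureMap FF.structureMap := by
  refine IsFibreBundle.of_isPullback fun b => ?_
  obtain ⟨σ, y, rfl⟩ := FB.exists_chartIncl b
  obtain ⟨L, hL⟩ := Φ.conewise_linear σ.1 σ.2
  set W := (twistedProduct FF Φ).preimage (LinearMap.fst ℤ NB NF) σ.1 with hW
  have e : ∀ z, (LinearMap.snd ℤ NB NF - L ∘ₗ LinearMap.fst ℤ NB NF).baseChange ℝ z =
      sndR NB NF z - L.baseChange ℝ (fstR NB NF z) := by
    intro z
    rw [LinearMap.baseChange_sub, LinearMap.baseChange_comp]
    rfl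
  have hq : IsFanMap (LinearMap.snd ℤ NB NF - L ∘ₗ LinearMap.fst ℤ NB NF) W FF := by
    rintro _ ⟨⟨ρ, τ, hτ, rfl⟩, hρ⟩
    refine ⟨τ, hτ, fun z hz => ?_⟩
    have hL' : ∀ x : FB.support, x.1 ∈ ρ.1 → Φ.toFun x = L.baseChange ℝ x.1 := by
      intro x hx
      obtain ⟨L', hL'⟩ := Φ.conewise_linear ρ.1 ρ.2
      refine hL x ?_
      have := hρ (inlR NB NF x.1 + inrR NB NF (L'.baseChange ℝ x.1)) (by
        rw [mem_twistedCone Φ hL']; simpa using hx)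
      change fstR NB NF _ ∈ _ at this
      simpa using this
    rw [e]
    exact ((mem_twistedCone Φ hL').mp hz).2
  refine ⟨_, _, FB.chartIncl σ, _, _, toricMap _ hq, inferInstance, ⟨y, rfl⟩,
    isPullback_preimage _ (isFanMap_fst FF Φ) σ, ?_⟩
  have hj : FB.chartIncl σ ≫ FB.structureMap =
      Spec.map (CommRingCat.ofHom (algebraMap ℂ (chartRing σ.1))) := Fan.chartIncl_glue _ _ _ _
  have hF : ∀ τ, FF.chartIncl τ ≫ FF.structureMap =
      Spec.map (CommRingCat.ofHom (algebraMap ℂ (chartRing τ.1))) := fun τ =>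
    Fan.chartIncl_glue _ _ _ _
  rw [hj]
  have h₁ : ∀ τ, MapsCone (LinearMap.fst ℤ NB NF) (twistedCone Φ σ τ) σ.1 := fun τ z hz =>
    ((mem_twistedCone Φ hL).mp hz).1
  have h₂ : ∀ τ, MapsCone (LinearMap.snd ℤ NB NF - L ∘ₗ LinearMap.fst ℤ NB NF)
      (twistedCone Φ σ τ) τ := fun τ z hz => by
    rw [e]; exact ((mem_twistedCone Φ hL).mp hz).2
  have hP := fun τ => isPullback_twistedCone Φ σ τ hL (h₁ τ) (h₂ τ)
  let C : FF.cones → W.cones := fun τ => ⟨twistedCone Φ σ τ.1, ⟨σ, τ.1, τ.2, rfl⟩, h₁ τ.1⟩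
  have hCa : ∀ τ, W.chartIncl (C τ) ≫ preimageToChart (twistedProduct FF Φ)
      (LinearMap.fst ℤ NB NF) σ.1 = chartMap _ (h₁ τ.1) := fun τ => Fan.chartIncl_glue _ _ _ _
  have hmax : ∀ (τ : FF.cones), ∀ D ∈ W.cones,
      MapsCone (LinearMap.snd ℤ NB NF - L ∘ₗ LinearMap.fst ℤ NB NF) D τ.1 → D ≤ (C τ).1 := by
    intro τ D hD hDτ z hz
    refine (mem_twistedCone Φ hL).mpr ⟨hD.2 z hz, ?_⟩
    rw [← e]
    exact hDτ z hz
  have H : ∀ τ : FF.cones, IsPullback (W.chartIncl (C τ) ≫ preimageToChart (twistedProduct FF Φ)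
      (LinearMap.fst ℤ NB NF) σ.1) (chartMap _ (h₂ τ.1))
      (Spec.map (CommRingCat.ofHom (algebraMap ℂ (chartRing σ.1))))
      (FF.chartIncl τ ≫ FF.structureMap) := by
    intro τ
    rw [hCa, hF]
    exact hP τ.1
  refine isPullback_of_openCover ?_ FF.openCover (fun τ => chart (C τ).1)
    (fun τ => W.chartIncl (C τ)) (fun τ => chartMap _ (h₂ τ.1)) (fun τ => ?_) (fun τ => ?_)
  · rw [toricMap_structureMap]
    refine Fan.hom_ext _ fun D => ?_
    rw [← Category.assoc, preimageToChart, Fan.chartIncl_glue, chartMap_algebraMap,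
      Fan.chartIncl_structureMap]
  · exact isPullback_chart _ hq (C τ) τ (h₂ τ.1) (hmax τ)
  · exact H τ

variable (FB) in
/-- A fibered toric variety over `X_{Σ_B}` with fibre `X_{Σ_F}`: the toric variety of a fan in
`N = N_B × N_F` (so that its torus is `T = T_B × T_F`) for which the projection `N → N_B` is a
map of fans and the induced toric morphism `π : X_Σ → X_{Σ_B}` is a fibre bundle with fibre
`X_{Σ_F}`. -/
structure FiberedToricVariety where
  fan : Fan (NB × NF)
  isFanMap : IsFanMap (LinearMap.fst ℤ NB NF) fan FB
  isFibreBundle : IsFibreBundle (toricMap (LinearMap.fst ℤ NB NF) isFanMap)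
    FB.structureMap FF.structureMap

/-- The projection `π : X_Σ → X_{Σ_B}` of a fibered toric variety. -/
def FiberedToricVariety.proj {FF : Fan NF} (E : FiberedToricVariety FB FF) :
    E.fan.toricVariety ⟶ FB.toricVariety :=
  toricMap (LinearMap.fst ℤ NB NF) E.isFanMap

/-- The fibered toric variety of the twisted product `Σ_B ⋉_Φ Σ_F`. -/
def twistedBundle : FiberedToricVariety FB FF where
  fan := twistedProduct FF Φ
  isFanMap := isFanMap_fst FF Φ
  isFibreBundle := isFibreBundle_twistedProduct FF Φ

/-- An isomorphism of fibered toric varieties over `X_{Σ_B}`: an isomorphism of schemes over `ℂ`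
that commutes with the projections to `X_{Σ_B}` and is toric, i.e. it restricts to the
isomorphism of the torus `T` given by an automorphism of the lattice `N`, and it is equivariant
along this isomorphism. -/
structure FiberedToricIso {FF : Fan NF} (E E' : FiberedToricVariety FB FF) where
  iso : E.fan.toricVariety ≅ E'.fan.toricVariety
  over_complex : iso.hom ≫ E'.fan.structureMap = E.fan.structureMap
  over_base : iso.hom ≫ E'.proj = E.proj
  lattice : (NB × NF) ≃ₗ[ℤ] (NB × NF)
  on_torus : torusIncl E.fan ≫ iso.hom = torusMap lattice.toLinearMap ≫ torusIncl E'.fan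
  equivariant : ∀ t : TorusPoint (NB × NF),
    torusAct E.fan t ≫ iso.hom = iso.hom ≫ torusAct E'.fan (t.map lattice.toLinearMap)

/-- The automorphism `(v₁, v₂) ↦ (v₁, v₂ + φ(v₁))` of the lattice `N = N_B × N_F`. -/
def shear (φ : NB →ₗ[ℤ] NF) : (NB × NF) ≃ₗ[ℤ] (NB × NF) where
  toFun v := (v.1, v.2 + φ v.1)
  invFun v := (v.1, v.2 - φ v.1)
  map_add' v w := by ext <;> simp; abel
  map_smul' c v := by ext <;> simp
  left_inv v := by simp
  right_inv v := by simp

end Twisted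

end Toric

end

namespace Toric

/-! ### Functoriality of toric varieties in maps of fans. -/

section Functoriality

variable {N N' N'' : Type} [AddCommGroup N] [AddCommGroup N'] [AddCommGroup N'']

/-! The content is a cancellation inside a single cone. If `Φ` agrees with a homomorphism `L` on
`σ`, then by `mem_twistedCone` a point `(x, y)` lies in the twisted cone of `σ` and `τ` exactly when
`x ∈ σ` and `y - L x ∈ τ`. On the same `σ` the map `Φ'` agrees with `L + φ`. The shear fixes `x` and
replaces `y` by `y + φ x`, and `(y + φ x) - (L + φ) x = y - L x`. So the shear carries each cone of
the first fan into the cone of the second with the same indices `σ` and `τ` (`mapsCone_shear`). It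
matters that `φ` is one homomorphism for all cones: `Φ` itself is only conewise linear, and shearing
by it would in general not be a lattice map.

The inverse of the shear is the shear by `-φ`, and `Φ = Φ' + (-φ)`, so the same argument with the
two twisting maps exchanged shows that the inverse is a map of fans too.

Everything else is functoriality. Toric morphisms compose as the lattice maps do (`toricMap_comp`,
`toricMap_id`), so mutually inverse maps of fans give an isomorphism (`toricIso`). It lies over
`X_{Σ_B}` because the shear does not change the first coordinate. That it lies over `ℂ`, restricts
to the homomorphism of tori and is equivariant holds for every toric morphism
(`toricMap_structureMap`, `torusIncl_toricMap`, `torusAct_toricMap`). -/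

lemma IsFanMap.comp {φ : N →ₗ[ℤ] N'} {ψ : N' →ₗ[ℤ] N''} {F : Fan N} {F' : Fan N'}
    {F'' : Fan N''} (h : IsFanMap φ F F') (h' : IsFanMap ψ F' F'') :
    IsFanMap (ψ ∘ₗ φ) F F'' := by
  intro σ hσ
  obtain ⟨σ', hσ', m⟩ := h σ hσ
  obtain ⟨σ'', hσ'', m'⟩ := h' σ' hσ'
  exact ⟨σ'', hσ'', m.comp m'⟩

/-- Morphisms out of `X_F` are determined on charts, where both sides are given by `χ^m ↦ χ^(m ∘ ψ ∘
φ)`. The target cones chosen in the definition of `toricMap` need not match for the two factors and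
the composite; `chartIncl_toricMap` allows any target cone, so one chain `σ`, `σ'`, `σ''` serves for
all three. -/
lemma toricMap_comp {φ : N →ₗ[ℤ] N'} {ψ : N' →ₗ[ℤ] N''} {F : Fan N} {F' : Fan N'}
    {F'' : Fan N''} (h : IsFanMap φ F F') (h' : IsFanMap ψ F' F'') :
    toricMap φ h ≫ toricMap ψ h' = toricMap (ψ ∘ₗ φ) (h.comp h') := by
  refine F.hom_ext fun σ => ?_
  obtain ⟨σ', hσ', m⟩ := h σ.1 σ.2
  obtain ⟨σ'', hσ'', m'⟩ := h' σ' hσ'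
  rw [← Category.assoc, chartIncl_toricMap φ h σ ⟨σ', hσ'⟩ m, Category.assoc,
    chartIncl_toricMap ψ h' ⟨σ', hσ'⟩ ⟨σ'', hσ''⟩ m', ← Category.assoc, chartMap_comp,
    chartIncl_toricMap _ (h.comp h') σ ⟨σ'', hσ''⟩ (m.comp m')]

/-- The fan-map proof depends on the lattice map, so an equation of lattice maps cannot simply be
rewritten inside `toricMap`. This form does the transport and leaves both proofs arbitrary. -/
lemma toricMap_congr {φ ψ : N →ₗ[ℤ] N'} (e : φ = ψ) {F : Fan N} {F' : Fan N'}
    (h : IsFanMap φ F F') (h' : IsFanMap ψ F F') : toricMap φ h = toricMap ψ h' := by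
  subst e; rfl

lemma toricMap_id {F : Fan N} (h : IsFanMap LinearMap.id F F) :
    toricMap LinearMap.id h = 𝟙 F.toricVariety := by
  refine F.hom_ext fun σ => ?_
  -- The cone that `h` provides may be strictly larger than `σ`; independence of this choice permits
  -- `σ` itself, where the chart map is the identity.
  rw [chartIncl_toricMap _ h σ σ (MapsCone.of_le le_rfl), chartMap_id, Category.id_comp,
    Category.comp_id]

/-- A lattice isomorphism that maps two fans into each other induces an isomorphism of toric
varieties. -/
noncomputable def toricIso (e : N ≃ₗ[ℤ] N') {F : Fan N} {F' : Fan N'}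
    (h : IsFanMap e.toLinearMap F F') (h' : IsFanMap e.symm.toLinearMap F' F) :
    F.toricVariety ≅ F'.toricVariety where
  hom := toricMap e.toLinearMap h
  inv := toricMap e.symm.toLinearMap h'
  hom_inv_id := by
    have hid : IsFanMap LinearMap.id F F := fun σ hσ => ⟨σ, hσ, MapsCone.of_le le_rfl⟩
    rw [toricMap_comp, toricMap_congr e.symm_comp _ hid, toricMap_id]
  inv_hom_id := by
    have hid : IsFanMap LinearMap.id F' F' := fun σ hσ => ⟨σ, hσ, MapsCone.of_le le_rfl⟩
    rw [toricMap_comp, toricMap_congr e.comp_symm _ hid, toricMap_id]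

/-- A toric morphism restricts to the induced homomorphism on the tori. -/
lemma torusIncl_toricMap (φ : N →ₗ[ℤ] N') {F : Fan N} {F' : Fan N'} (h : IsFanMap φ F F') :
    torusIncl F ≫ toricMap φ h = torusMap φ ≫ torusIncl F' := by
  -- Taking the zero cone as target of the zero cone makes the morphism land in the torus chart of
  -- `X_F'`, whichever cone `h` provides.
  have h0 : MapsCone φ (⊥ : PointedCone ℝ (RealSpace N)) (⊥ : PointedCone ℝ (RealSpace N')) := by
    intro x hx
    rw [Submodule.mem_bot] at hx ⊢
    rw [hx, map_zero]
  rw [torusIncl, torusIncl, Category.assoc,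
    chartIncl_toricMap φ h ⟨⊥, F.bot_mem⟩ ⟨⊥, F'.bot_mem⟩ h0, ← Category.assoc, ← Category.assoc]
  congr 1
  rw [chartMap, torusMap, ← Spec.map_comp, ← Spec.map_comp, ← CommRingCat.ofHom_comp,
    ← CommRingCat.ofHom_comp, ← AddMonoidAlgebra.mapDomainRingHom_comp,
    ← AddMonoidAlgebra.mapDomainRingHom_comp]
  -- Both ring homomorphisms now come from the same map of monoids, `m ↦ m ∘ φ` from the semigroup
  -- of the zero cone in `N'` to the dual lattice of `N`.
  rfl

/-- A toric morphism is equivariant along the induced homomorphism of the tori. -/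
lemma torusAct_toricMap (φ : N →ₗ[ℤ] N') {F : Fan N} {F' : Fan N'} (h : IsFanMap φ F F')
    (t : TorusPoint N) :
    torusAct F t ≫ toricMap φ h = toricMap φ h ≫ torusAct F' (t.map φ) := by
  refine F.hom_ext fun σ => ?_
  obtain ⟨σ', hσ', m⟩ := h σ.1 σ.2
  -- The torus action preserves every chart, so the same pair `σ`, `σ'` can be used on both sides,
  -- and what remains is equivariance of one chart map.
  rw [← Category.assoc, ← Category.assoc, chartIncl_toricMap φ h σ ⟨σ', hσ'⟩ m, torusAct,
    Fan.chartIncl_glue, Category.assoc, chartIncl_toricMap φ h σ ⟨σ', hσ'⟩ m, Category.assoc,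
    torusAct, Fan.chartIncl_glue, ← Category.assoc, ← Category.assoc, chartMap_chartAct]

end Functoriality

/-! ### The shear and its effect on twisted products. -/

section Shear

variable {NB NF : Type} [AddCommGroup NB] [AddCommGroup NF]

/-- This reduces the inverse direction to the forward one: no second computation with cones is
needed. -/
lemma shear_symm (φ : NB →ₗ[ℤ] NF) : (shear φ).symm = shear (-φ) :=
  LinearEquiv.ext fun v => Prod.ext rfl (sub_eq_add_neg v.2 (φ v.1))

/-- This identity of lattice maps is the reason why the induced isomorphism commutes with the
projections to `X_{Σ_B}`. -/
lemma fst_comp_shear (φ : NB →ₗ[ℤ] NF) :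
    LinearMap.fst ℤ NB NF ∘ₗ (shear φ).toLinearMap = LinearMap.fst ℤ NB NF := rfl

lemma snd_comp_shear (φ : NB →ₗ[ℤ] NF) :
    LinearMap.snd ℤ NB NF ∘ₗ (shear φ).toLinearMap =
      LinearMap.snd ℤ NB NF + φ ∘ₗ LinearMap.fst ℤ NB NF := rfl

lemma fstR_shear (φ : NB →ₗ[ℤ] NF) (z : RealSpace (NB × NF)) :
    fstR NB NF ((shear φ).toLinearMap.baseChange ℝ z) = fstR NB NF z := by
  rw [fstR, ← LinearMap.comp_apply, ← LinearMap.baseChange_comp, fst_comp_shear]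

/-- The extra term is the one that cancels the change from `L` to `L + φ` in the membership
criterion for twisted cones. -/
lemma sndR_shear (φ : NB →ₗ[ℤ] NF) (z : RealSpace (NB × NF)) :
    sndR NB NF ((shear φ).toLinearMap.baseChange ℝ z) =
      sndR NB NF z + φ.baseChange ℝ (fstR NB NF z) := by
  rw [sndR, fstR, ← LinearMap.comp_apply, ← LinearMap.baseChange_comp, snd_comp_shear,
    LinearMap.baseChange_add, LinearMap.baseChange_comp]
  rfl

/-- The shear by `φ` maps `σ̃ + τ`, formed with `Φ`, into `σ̃ + τ`, formed with `Φ + φ`. -/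
lemma mapsCone_shear {FB : Fan NB} {Φ Φ' : TwistingMap NF FB} {φ : NB →ₗ[ℤ] NF}
    (hφ : ∀ x : FB.support, Φ'.toFun x = Φ.toFun x + φ.baseChange ℝ x.1)
    (σ : FB.cones) (τ : PointedCone ℝ (RealSpace NF)) :
    MapsCone (shear φ).toLinearMap (twistedCone Φ σ τ) (twistedCone Φ' σ τ) := by
  obtain ⟨L, hL⟩ := Φ.conewise_linear σ.1 σ.2
  -- The homomorphism that `Φ'.conewise_linear` provides has no direct relation to `L` away from the
  -- span of `σ`. Since `mem_twistedCone` accepts any homomorphism that agrees with `Φ'` on `σ`, the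
  -- choice `L + φ` is available and makes the cancellation literal.
  have hL' : ∀ x : FB.support, x.1 ∈ σ.1 → Φ'.toFun x = (L + φ).baseChange ℝ x.1 := by
    intro x hx
    rw [hφ, hL x hx, LinearMap.baseChange_add, LinearMap.add_apply]
  intro z hz
  rw [mem_twistedCone Φ hL] at hz
  rw [mem_twistedCone Φ' hL', fstR_shear, sndR_shear, LinearMap.baseChange_add,
    LinearMap.add_apply, add_sub_add_right_eq_sub]
  exact hz

lemma isFanMap_shear {FB : Fan NB} (FF : Fan NF) {Φ Φ' : TwistingMap NF FB} {φ : NB →ₗ[ℤ] NF}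
    (hφ : ∀ x : FB.support, Φ'.toFun x = Φ.toFun x + φ.baseChange ℝ x.1) :
    IsFanMap (shear φ).toLinearMap (twistedProduct FF Φ) (twistedProduct FF Φ') := by
  rintro _ ⟨σ, τ, hτ, rfl⟩
  exact ⟨_, ⟨σ, τ, hτ, rfl⟩, mapsCone_shear hφ σ τ⟩

/-- The hypothesis is symmetric under exchanging `Φ` with `Φ'` and `φ` with `-φ`. Together with
`isFanMap_shear` this provides the two inputs of `toricIso`. -/
lemma isFanMap_shear_symm {FB : Fan NB} (FF : Fan NF) {Φ Φ' : TwistingMap NF FB}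
    {φ : NB →ₗ[ℤ] NF}
    (hφ : ∀ x : FB.support, Φ'.toFun x = Φ.toFun x + φ.baseChange ℝ x.1) :
    IsFanMap (shear φ).symm.toLinearMap (twistedProduct FF Φ') (twistedProduct FF Φ) := by
  rw [shear_symm]
  refine isFanMap_shear FF fun x => ?_
  rw [hφ, LinearMap.baseChange_neg, LinearMap.neg_apply, add_neg_cancel_right]

/-- The isomorphism of fibered toric varieties induced by the shear by `φ`. -/
noncomputable def shearIso {FB : Fan NB} (FF : Fan NF) {Φ Φ' : TwistingMap NF FB}
    {φ : NB →ₗ[ℤ] NF}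
    (hφ : ∀ x : FB.support, Φ'.toFun x = Φ.toFun x + φ.baseChange ℝ x.1) :
    FiberedToricIso (twistedBundle FF Φ) (twistedBundle FF Φ') where
  iso := toricIso (shear φ) (isFanMap_shear FF hφ) (isFanMap_shear_symm FF hφ)
  over_complex := toricMap_structureMap _ (isFanMap_shear FF hφ)
  -- Both projections are the toric morphisms of the first projection of lattices, so the triangle
  -- of schemes is the image of a commuting triangle of lattices.
  over_base := (toricMap_comp (isFanMap_shear FF hφ) (isFanMap_fst FF Φ')).trans
    (toricMap_congr (fst_comp_shear φ) _ _)
  lattice := shear φ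
  on_torus := torusIncl_toricMap _ (isFanMap_shear FF hφ)
  equivariant := torusAct_toricMap _ (isFanMap_shear FF hφ)

end Shear

end Toric

/-- A `FiberedToricIso` leaves its lattice automorphism and its underlying morphism free; the two
equations pin them to the shear and to the toric morphism that it induces. -/
theorem proposition2p3 {NB NF : Type}
    [AddCommGroup NB] [Module.Free ℤ NB] [Module.Finite ℤ NB]
    [AddCommGroup NF] [Module.Free ℤ NF] [Module.Finite ℤ NF]
    (FB : Toric.Fan NB) (FF : Toric.Fan NF) (Φ Φ' : Toric.TwistingMap NF FB)
    (φ : NB →ₗ[ℤ] NF)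
    (hφ : ∀ x : FB.support, Φ'.toFun x = Φ.toFun x + φ.baseChange ℝ x.1) :
    ∃ h : Toric.IsFanMap (Toric.shear φ).toLinearMap
        (Toric.twistedProduct FF Φ) (Toric.twistedProduct FF Φ'),
      ∃ e : Toric.FiberedToricIso (Toric.twistedBundle FF Φ) (Toric.twistedBundle FF Φ'),
        e.lattice = Toric.shear φ ∧
        e.iso.hom = Toric.toricMap (Toric.shear φ).toLinearMap h :=
  -- Both equations hold by definition, since `shearIso` is built from `shear φ` through `toricIso`,
  -- whose forward morphism is the toric one.
  ⟨Toric.isFanMap_shear FF hφ, Toric.shearIso FF hφ, rfl, rfl⟩
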